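/- Let $p$ and $q$ be coprime integers with $0 < p < q$ and $p + q$ odd. A $(p,q)$-leaper moves from a square $a$ to any of the squares $a + (\pm p, \pm q)$, $a + (\pm q, \pm p)$. Let $G$ be its leaper graph over the $(p+q)\times(p+q)$ chessboard (squares are vertices, moves are edges). *Frames.* For $0 < m < n$, the $(m,n)$-frame is the $(m+n)\times(m+n)$ chessboard with the central $(n-m)\times(n-m)$ square removed; extending the sides of the central hole divides it into eight sections, one in each of the directions E, NE, N, …, SE. All frames are concentric. Given a set $S$ of squares of the $(m,n)$-frame $F$, define three lifted sets, each of the form $\bigcup_d (S + v_d)\cap H_d$, where $d$ ranges over the eight directions, $H_d$ is the section of the larger frame $H$ in direction $d$, and $v_d$ points in direction $d$: - $f(S)$: $H$ is the $(m, 2m+n)$-frame and the $v_d$ are the moves of a $(0,m+n)$-leaper and of an $(m,m)$-leaper; - $g(S)$: $H$ is the $(n, 2n-m)$-frame and the $v_d$ are the moves of a $(0,n-m)$-leaper and of an $(n,n)$-leaper; - $h(S)$: $H$ is the $(n, m+2n)$-frame and the $v_d$ are the moves of a $(0,m+n)$-leaper and of an $(n,n)$-leaper. *Shells.* For $m < n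 \le 3m$, the shell of the $(m,n)$-frame is a union of eight square subboards, one placed symmetrically in each section. If $n \le 2m$, they have side $n-m$; four lie in the corners of the board and four are adjacent by side to the central hole. If $2m \le n \le 3m$, they have side $3m-n$; four lie in the middle of the outer sides and four are adjacent by corner to the central hole. *Types.* The type of a cycle of the $(m,n)$-leaper within the $(m+n)\times(m+n)$ chessboard is defined recursively through its set of squares. A cycle contained in the shell has type $1$. If $S$ is the set of squares of a cycle of type $i$ of the $(m,n)$-leaper, then cycles with sets of squares $f(S)$, $g(S)$, $h(S)$ have types $i$, $i+1$, $i+1$, respectively. Write $$[a_1\pm, a_2\pm, \ldots, a_r] = a_1 \pm \cfrac{1}{a_2 \pm \cfrac{1}{\ddots \pm \frac{1}{a_r}}},$$ where each $\pm$ is a fixed sign. Let $$\frac{q}{p} = [c_1\pm, c_2\pm, \ldots, c_k]$$ with all $c_i$ even integers, $c_1 \ge 0$ and $c_2, \ldots, c_k > 0$, and, for $i = 1, \ldots, k$, let $$\frac{l_i}{d_i} = [c_1\pm, 2-, c_2\pm, 2-, \ldots, c_i]$$ in lowest terms with $d_i>0$, where the sign following each $c_j$ is the same as in the expansion of $\frac{q}{p}$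 and the sign following each $2$ is $-$. Then every cycle of $G$ has exactly one type, which is one of $1, \ldots, k$; for each $i = 1, \ldots, k$ there are cycles of type $i$ in $G$; and every cycle of type $i$ has length $4l_i$. -/

import Mathlib

namespace Leaper

/-! ### Boards, leaper graphs and cycles

A square is identified with the integer point at its center.  Only boards of odd side occur, and
they are placed so that the central square is the origin. -/

/-- The `N × N` chessboard (`N` odd) centered at the origin. -/
def board (N : ℕ) : Set (ℤ × ℤ) :=
  {s | |2 * s.1| < (N : ℤ) ∧ |2 * s.2| < (N : ℤ)}

/-- The moves of a `(p, q)`-leaper on the infinite chessboard. -/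
def moveGraph (p q : ℕ) : SimpleGraph (ℤ × ℤ) where
  Adj a b := a ≠ b ∧
    ((|a.1 - b.1| = (p : ℤ) ∧ |a.2 - b.2| = (q : ℤ)) ∨
      (|a.1 - b.1| = (q : ℤ) ∧ |a.2 - b.2| = (p : ℤ)))
  symm := ⟨fun a b h => by
    rw [abs_sub_comm b.1 a.1, abs_sub_comm b.2 a.2]
    exact ⟨h.1.symm, h.2⟩⟩
  loopless := ⟨fun _ h => h.1 rfl⟩

/-- The leaper graph of a `(p, q)`-leaper over the `(p + q) × (p + q)` chessboard. -/
def leaperGraph (p q : ℕ) : SimpleGraph (board (p + q)) :=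
  (moveGraph p q).induce (board (p + q))

/-- The set of squares visited by a walk in the leaper graph. -/
def squares {p q : ℕ} {a b : board (p + q)} (C : (leaperGraph p q).Walk a b) : Set (ℤ × ℤ) :=
  Subtype.val '' {s | s ∈ C.support}

/-- `S` is the vertex set of a cycle of the `(p, q)`-leaper within the `(p + q) × (p + q)` board. -/
def IsCycleSet (p q : ℕ) (S : Set (ℤ × ℤ)) : Prop :=
  ∃ (a : board (p + q)) (C : (leaperGraph p q).Walk a a), C.IsCycle ∧ squares C = S

/-! ### Frames and their sections

The `(p, q)`-frame, `p < q`, is the `(p + q) × (p + q)` board without the central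
`(q - p) × (q - p)` square.  The eight directions E, NE, …, SE are the nonzero vectors of signs:
E is `(1, 0)`, NE is `(1, 1)`, N is `(0, 1)`, and so on. -/

/-- The coordinate `x` lies in the negative, the middle or the positive one of the three bands
into which the sides of the central hole, extended, divide the board. -/
def InBand (p q : ℕ) : SignType → ℤ → Prop
  | .neg, x => -((p : ℤ) + q) < 2 * x ∧ 2 * x < -((q : ℤ) - p)
  | .zero, x => |2 * x| < (q : ℤ) - p
  | .pos, x => (q : ℤ) - p < 2 * x ∧ 2 * x < (p : ℤ) + q

/-- The section of the `(p, q)`-frame in the direction `d`. -/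
def frameSection (p q : ℕ) (d : SignType × SignType) : Set (ℤ × ℤ) :=
  {s | InBand p q d.1 s.1 ∧ InBand p q d.2 s.2}

/-! ### Lifting transformations -/

/-- The translation vector pointing in direction `d` which is a move of a `(0, a)`-leaper if `d` is
E, N, W or S, and a move of a `(b, b)`-leaper if `d` is NE, NW, SW or SE. -/
def dirVector (a b : ℤ) (d : SignType × SignType) : ℤ × ℤ :=
  if d.1 = 0 ∨ d.2 = 0 then (a * (d.1 : ℤ), a * (d.2 : ℤ)) else (b * (d.1 : ℤ), b * (d.2 : ℤ))

/-- The union, over the eight directions `d`, of `(S + v_d) ∩ H_d`, where `H` is the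
`(p, q)`-frame and `v_d = dirVector a b d`. -/
def lift (p q : ℕ) (a b : ℤ) (S : Set (ℤ × ℤ)) : Set (ℤ × ℤ) :=
  {s | ∃ d : SignType × SignType, d ≠ 0 ∧ s ∈ frameSection p q d ∧ s - dirVector a b d ∈ S}

/-- The transformation `f`, from the `(m, n)`-frame to the `(m, 2m + n)`-frame. -/
def liftF (m n : ℕ) (S : Set (ℤ × ℤ)) : Set (ℤ × ℤ) :=
  lift m (2 * m + n) ((m : ℤ) + n) m S

/-- The transformation `g`, from the `(m, n)`-frame (`m < n`) to the `(n, 2n - m)`-frame. -/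
def liftG (m n : ℕ) (S : Set (ℤ × ℤ)) : Set (ℤ × ℤ) :=
  lift n (2 * n - m) ((n : ℤ) - m) n S

/-- The transformation `h`, from the `(m, n)`-frame to the `(n, m + 2n)`-frame. -/
def liftH (m n : ℕ) (S : Set (ℤ × ℤ)) : Set (ℤ × ℤ) :=
  lift n (m + 2 * n) ((m : ℤ) + n) n S

/-! ### Shells -/

/-- One coordinate of a point of the square subboard in a given direction: `|2x| < mid` if the
direction has component `e = 0`, and `lo < 2ex < hi` if it has component `e = ±1`. -/
def InSpan (mid lo hi : ℤ) (e : SignType) (x : ℤ) : Prop :=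
  if e = 0 then |2 * x| < mid else lo < 2 * (e : ℤ) * x ∧ 2 * (e : ℤ) * x < hi

/-- The shell of the `(m, n)`-frame, `m < n ≤ 3m`: the union of eight square subboards, one in each
direction.

If `n ≤ 2m`, their side is `n - m`, four of them lie in the corners of the board and four are
adjacent by side to the central hole.  Otherwise their side is `3m - n`, four of them lie in the
middle of the outer sides and four are adjacent by corner to the central hole. -/
def shell (m n : ℕ) : Set (ℤ × ℤ) :=
  {s | ∃ d : SignType × SignType, d ≠ 0 ∧
    if n ≤ 2 * m then
      if d.1 = 0 ∨ d.2 = 0 then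
        InSpan ((n : ℤ) - m) ((n : ℤ) - m) (3 * ((n : ℤ) - m)) d.1 s.1 ∧
        InSpan ((n : ℤ) - m) ((n : ℤ) - m) (3 * ((n : ℤ) - m)) d.2 s.2
      else
        InSpan ((n : ℤ) - m) ((m : ℤ) + n - 2 * ((n : ℤ) - m)) ((m : ℤ) + n) d.1 s.1 ∧
        InSpan ((n : ℤ) - m) ((m : ℤ) + n - 2 * ((n : ℤ) - m)) ((m : ℤ) + n) d.2 s.2
    else
      if d.1 = 0 ∨ d.2 = 0 then
        InSpan (3 * (m : ℤ) - n) ((m : ℤ) + n - 2 * (3 * (m : ℤ) - n)) ((m : ℤ) + n) d.1 s.1 ∧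
        InSpan (3 * (m : ℤ) - n) ((m : ℤ) + n - 2 * (3 * (m : ℤ) - n)) ((m : ℤ) + n) d.2 s.2
      else
        InSpan (3 * (m : ℤ) - n) ((n : ℤ) - m) ((n : ℤ) - m + 2 * (3 * (m : ℤ) - n)) d.1 s.1 ∧
        InSpan (3 * (m : ℤ) - n) ((n : ℤ) - m) ((n : ℤ) - m + 2 * (3 * (m : ℤ) - n)) d.2 s.2}

/-! ### The type of a cycle -/

/-- `HasType p q i S`: `S` is the set of squares of a cycle of type `i` of the `(p, q)`-leaper.
The cycles within the shell have type `1`; lifting by `f` preserves the type of a cycle and lifting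
by `g` or `h` increases it by one.  (The shell of the `(1, 2)`-frame, with which every sequence of
liftings begins, is the whole frame.) -/
inductive HasType : ℕ → ℕ → ℕ → Set (ℤ × ℤ) → Prop
  | shell (m n : ℕ) (S : Set (ℤ × ℤ)) (hm : 0 < m) (hmn : m < n) (hn : n ≤ 3 * m)
      (hS : IsCycleSet m n S) (hsub : S ⊆ shell m n) : HasType m n 1 S
  | f (m n i : ℕ) (S : Set (ℤ × ℤ)) (hmn : m < n) (hS : HasType m n i S) :
      HasType m (2 * m + n) i (liftF m n S)
  | g (m n i : ℕ) (S : Set (ℤ × ℤ)) (hmn : m < n) (hS : HasType m n i S) :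
      HasType n (2 * n - m) (i + 1) (liftG m n S)
  | h (m n i : ℕ) (S : Set (ℤ × ℤ)) (hmn : m < n) (hS : HasType m n i S) :
      HasType n (m + 2 * n) (i + 1) (liftH m n S)

/-! ### Continued fractions -/

/-- `signedCF [(a₁, s₁), …, (aₙ, sₙ)] b` is `a₁ + s₁ / (a₂ + s₂ / (… + sₙ / b))`, where the signs
`sⱼ` are `1` or `-1`. -/
def signedCF : List (ℤ × ℤˣ) → ℤ → ℚ
  | [], b => b
  | (a, s) :: t, b => a + ((s : ℤ) : ℚ) / signedCF t b

/-- `[c₁±, c₂±, …, c_k]`, where `s i` is the sign following `c i`. -/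
def cfValue (c : ℕ → ℤ) (s : ℕ → ℤˣ) (k : ℕ) : ℚ :=
  signedCF ((List.Ico 1 k).map fun j => (c j, s j)) (c k)

/-- `[c₁±, …, c_k]` is an even continued fraction. -/
def IsEvenCF (c : ℕ → ℤ) (k : ℕ) : Prop :=
  1 ≤ k ∧ (∀ i ∈ Finset.Icc 1 k, Even (c i)) ∧ 0 ≤ c 1 ∧ ∀ i ∈ Finset.Icc 2 k, 0 < c i

/-- `[c₁±, 2-, c₂±, 2-, …, c_i]`, where `s j` is the sign following `c j`. -/
def lengthRatio (c : ℕ → ℤ) (s : ℕ → ℤˣ) (i : ℕ) : ℚ :=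
  signedCF ((List.Ico 1 i).flatMap fun j => [(c j, s j), (2, -1)]) (c i)

end Leaper

/-! Every square of the frame has exactly two neighbours on the board and every square of the
central hole has none. So the vertex sets of cycles are exactly the connected components of frame
squares, and walks can be replaced by components (`squares_eq_comp`, `isCycleSet_comp`).

Put m = |q - 2p|. The three liftings are one construction: subtracting from a frame square the
vector of its section maps the frame into the board of the leaper with moves m and p, and the lift
of S is the preimage of S. The (at most eight) squares over one u, in the cyclic order of sections
NE, S, NW, E, SW, N, SE, W, have consecutive terms one move apart, and those that exist form an arc
of this octagon; so fibres are connected. The remaining moves join opposite sections and project to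
moves of the smaller leaper, all of whose moves arise in this way. Hence the component of a square
is the lift of the component of its image (`comp_eq_lift`).

If m > p (that is, q > 3p), the smaller frame is the (p, m)-frame, the lifting is f, and the hole
has no lifts. If m < p, the lifting is g or h from the (m, p)-frame, and each isolated hole square
lifts to a full octagon; these octagons fill the shell and are the cycles of type 1 of this frame.
Iterating is a Euclidean descent which follows the even continued fraction: f subtracts 2 from c₁,
while g and h strip the term c₁ = 2 followed by a minus or a plus.

For lengths, corner and side squares are counted separately, since the number of lifts of a square
depends only on this kind and on the lifting. A cycle of type i has 4d corner squares and 4l squares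
in all, where l/d is the reduced `lengthRatio`; the induced linear maps on (l, d) are those of the
continued fraction with the inserted 2's (`Classified`). -/

namespace Leaper

/-! ### The leaper graph on the infinite board and its components -/

/-- The leaper graph over the `(p + q) × (p + q)` board, with all other integer points added as
isolated vertices. -/
def boardGraph (p q : ℕ) : SimpleGraph (ℤ × ℤ) where
  Adj a b := (moveGraph p q).Adj a b ∧ a ∈ board (p + q) ∧ b ∈ board (p + q)
  symm := ⟨fun _ _ h => ⟨h.1.symm, h.2.2, h.2.1⟩⟩
  loopless := ⟨fun _ h => h.1.ne rfl⟩

/-- The connected component of a square, as a set. -/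
def comp (p q : ℕ) (s : ℤ × ℤ) : Set (ℤ × ℤ) := {t | (boardGraph p q).Reachable s t}

/-- The squares of the `(p, q)`-frame. -/
def frame (p q : ℕ) : Set (ℤ × ℤ) := {s | ∃ d : SignType × SignType, d ≠ 0 ∧ s ∈ frameSection p q d}

lemma mem_board_iff {p q : ℕ} {x y : ℤ} : (x, y) ∈ board (p + q) ↔
    (-((p : ℤ) + q) < 2 * x ∧ 2 * x < (p : ℤ) + q) ∧
      (-((p : ℤ) + q) < 2 * y ∧ 2 * y < (p : ℤ) + q) := by
  simp only [board, Set.mem_ofPred_eq, abs_lt, Nat.cast_add]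

lemma abs_sub_eq_nat_iff {a b : ℤ} {n : ℕ} : |a - b| = (n : ℤ) ↔ b = a + n ∨ b = a - n := by
  rw [abs_eq (by positivity)]
  omega

lemma boardGraph_adj_iff {p q : ℕ} (hq : 0 < q) {x y z w : ℤ} :
    (boardGraph p q).Adj (x, y) (z, w) ↔
      (((z = x + p ∨ z = x - p) ∧ (w = y + q ∨ w = y - q)) ∨
        ((z = x + q ∨ z = x - q) ∧ (w = y + p ∨ w = y - p))) ∧
      ((-((p : ℤ) + q) < 2 * x ∧ 2 * x < (p : ℤ) + q) ∧
        (-((p : ℤ) + q) < 2 * y ∧ 2 * y < (p : ℤ) + q)) ∧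
      ((-((p : ℤ) + q) < 2 * z ∧ 2 * z < (p : ℤ) + q) ∧
        (-((p : ℤ) + q) < 2 * w ∧ 2 * w < (p : ℤ) + q)) := by
  simp only [boardGraph, moveGraph, mem_board_iff, abs_sub_eq_nat_iff, ne_eq, Prod.mk.injEq]
  constructor
  · rintro ⟨⟨-, h⟩, h1, h2⟩
    exact ⟨h, h1, h2⟩
  · rintro ⟨h, h1, h2⟩
    exact ⟨⟨by omega, h⟩, h1, h2⟩

lemma boardGraph_comm (p q : ℕ) : boardGraph p q = boardGraph q p := by
  ext a b
  simp only [boardGraph, moveGraph, Nat.add_comm p q]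
  tauto

lemma inBand_neg {p q : ℕ} {x : ℤ} : InBand p q (-1) x ↔
    -((p : ℤ) + q) < 2 * x ∧ 2 * x < -((q : ℤ) - p) := Iff.rfl

lemma inBand_zero {p q : ℕ} {x : ℤ} : InBand p q 0 x ↔
    -((q : ℤ) - p) < 2 * x ∧ 2 * x < (q : ℤ) - p := abs_lt

lemma inBand_one {p q : ℕ} {x : ℤ} : InBand p q 1 x ↔
    (q : ℤ) - p < 2 * x ∧ 2 * x < (p : ℤ) + q := Iff.rfl

lemma exists_dir_iff {P : SignType × SignType → Prop} :
    (∃ d : SignType × SignType, d ≠ 0 ∧ P d) ↔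
      P (1, 0) ∨ P (1, 1) ∨ P (0, 1) ∨ P (-1, 1) ∨ P (-1, 0) ∨ P (-1, -1) ∨ P (0, -1) ∨
        P (1, -1) := by
  constructor
  · rintro ⟨⟨d, e⟩, h0, h⟩
    cases d <;> cases e <;> simp_all
  · rintro (h | h | h | h | h | h | h | h) <;> exact ⟨_, by decide, h⟩

/-- Parity makes `2 * x` different from ±(q - p), so the three bands exhaust each coordinate and the
sections miss only the hole. -/
lemma mem_frame_iff {p q : ℕ} (hpq : p < q) (hodd : Odd (p + q)) {x y : ℤ} : (x, y) ∈ frame p q ↔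
    (x, y) ∈ board (p + q) ∧ ¬ ((-((q : ℤ) - p) < 2 * x ∧ 2 * x < (q : ℤ) - p) ∧
      (-((q : ℤ) - p) < 2 * y ∧ 2 * y < (q : ℤ) - p)) := by
  obtain ⟨k, hk⟩ := hodd
  simp only [frame, Set.mem_ofPred_eq, exists_dir_iff, frameSection, inBand_neg, inBand_zero,
    inBand_one, mem_board_iff]
  omega

lemma frame_subset_board {p q : ℕ} (hpq : p < q) (hodd : Odd (p + q)) :
    frame p q ⊆ board (p + q) := fun ⟨_, _⟩ h => ((mem_frame_iff hpq hodd).1 h).1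

/-! ### Cycles are components -/

/-- In each section exactly two of the eight moves stay on the board. From a side section both go q
towards the opposite side and p to either hand; from a corner section both go inwards in both
coordinates. -/
lemma ncard_neighborSet_boardGraph {p q : ℕ} (hp : 0 < p) (hpq : p < q) (hodd : Odd (p + q))
    {s : ℤ × ℤ} (hs : s ∈ frame p q) : ((boardGraph p q).neighborSet s).ncard = 2 := by
  obtain ⟨x, y⟩ := s
  obtain ⟨k, hk⟩ := hodd
  suffices ∃ a b : ℤ × ℤ, a ≠ b ∧ (boardGraph p q).neighborSet (x, y) = {a, b} by
    obtain ⟨a, b, hab, h⟩ := this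
    rw [h, Set.ncard_pair hab]
  have key : ∀ a b c d : ℤ, (a ≠ c ∨ b ≠ d) →
      (∀ z w, (boardGraph p q).Adj (x, y) (z, w) ↔ (z = a ∧ w = b) ∨ (z = c ∧ w = d)) →
      ∃ a b : ℤ × ℤ, a ≠ b ∧ (boardGraph p q).neighborSet (x, y) = {a, b} := by
    intro a b c d h1 h2
    refine ⟨(a, b), (c, d), ?_, ?_⟩
    · simp only [ne_eq, Prod.mk.injEq]; omega
    · ext ⟨z, w⟩
      simp only [SimpleGraph.mem_neighborSet, Set.mem_insert_iff, Set.mem_singleton_iff,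
        Prod.mk.injEq, h2]
  simp only [boardGraph_adj_iff (hp.trans hpq)] at key
  simp only [frame, Set.mem_ofPred_eq, exists_dir_iff, frameSection, inBand_neg, inBand_zero,
    inBand_one] at hs
  rcases hs with h | h | h | h | h | h | h | h
  · exact key (x - q) (y + p) (x - q) (y - p) (by omega) (by intros; omega)
  · exact key (x - q) (y - p) (x - p) (y - q) (by omega) (by intros; omega)
  · exact key (x + p) (y - q) (x - p) (y - q) (by omega) (by intros; omega)
  · exact key (x + q) (y - p) (x + p) (y - q) (by omega) (by intros; omega)
  · exact key (x + q) (y + p) (x + q) (y - p) (by omega) (by intros; omega)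
  · exact key (x + q) (y + p) (x + p) (y + q) (by omega) (by intros; omega)
  · exact key (x + p) (y + q) (x - p) (y + q) (by omega) (by intros; omega)
  · exact key (x - q) (y + p) (x - p) (y + q) (by omega) (by intros; omega)

/-- A hole square has both coordinates below (q - p)/2 in absolute value, so changing either one by
q leaves the board. -/
lemma mem_frame_of_adj {p q : ℕ} (hpq : p < q) (hodd : Odd (p + q))
    {s t : ℤ × ℤ} (h : (boardGraph p q).Adj s t) : s ∈ frame p q := by
  obtain ⟨x, y⟩ := s
  obtain ⟨z, w⟩ := t
  rw [boardGraph_adj_iff (by omega)] at h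
  rw [mem_frame_iff hpq hodd, mem_board_iff]
  refine ⟨h.2.1, ?_⟩
  rcases h with ⟨⟨h1 | h1, h2 | h2⟩ | ⟨h1 | h1, h2 | h2⟩, h3, h4⟩ <;> omega

lemma self_mem_comp (p q : ℕ) (s : ℤ × ℤ) : s ∈ comp p q s := SimpleGraph.Reachable.refl s

lemma comp_induction {p q : ℕ} {s t : ℤ × ℤ} {P : ℤ × ℤ → Prop} (h : t ∈ comp p q s) (h0 : P s)
    (hstep : ∀ u v, (boardGraph p q).Adj u v → P u → P v) : P t := by
  obtain ⟨w⟩ := h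
  induction w with
  | nil => exact h0
  | cons hadj _ ih => exact ih (hstep _ _ hadj h0)

lemma comp_eq_singleton {p q : ℕ} (hpq : p < q) (hodd : Odd (p + q))
    {s : ℤ × ℤ} (hs : s ∉ frame p q) : comp p q s = {s} := by
  ext t
  refine ⟨fun h => ?_, fun h => h ▸ self_mem_comp p q s⟩
  refine comp_induction (P := fun t => t ∈ ({s} : Set (ℤ × ℤ))) h rfl fun u v huv hu => ?_
  rw [Set.mem_singleton_iff] at hu
  exact absurd (mem_frame_of_adj hpq hodd huv) (hu ▸ hs)

lemma comp_subset_frame {p q : ℕ} (hpq : p < q) (hodd : Odd (p + q)) {s : ℤ × ℤ}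
    (hs : s ∈ frame p q) : comp p q s ⊆ frame p q := fun _ h =>
  comp_induction (P := fun t => t ∈ frame p q) h hs
    fun _ _ huv _ => mem_frame_of_adj hpq hodd huv.symm

lemma finite_board (N : ℕ) : (board N).Finite := by
  refine ((Set.finite_Icc (-(N : ℤ)) N).prod (Set.finite_Icc (-(N : ℤ)) N)).subset ?_
  rintro ⟨x, y⟩ h
  simp only [board, Set.mem_ofPred_eq, abs_lt] at h
  simp only [Set.mem_prod, Set.mem_Icc]
  omega

lemma leaperGraph_adj_iff {p q : ℕ} {a b : board (p + q)} :
    (leaperGraph p q).Adj a b ↔ (boardGraph p q).Adj a.1 b.1 :=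
  ⟨fun h => ⟨h, a.2, b.2⟩, fun h => h.1⟩

lemma reachable_leaperGraph_iff {p q : ℕ} {a b : board (p + q)} :
    (leaperGraph p q).Reachable a b ↔ (boardGraph p q).Reachable a.1 b.1 := by
  constructor
  · rintro ⟨w⟩
    induction w with
    | nil => exact .refl _
    | cons hadj _ ih => exact (leaperGraph_adj_iff.1 hadj).reachable.trans ih
  · intro h
    have := comp_induction (P := fun t => ∃ ht : t ∈ board (p + q),
      (leaperGraph p q).Reachable a ⟨t, ht⟩) h ⟨a.2, .refl _⟩ ?_
    · exact this.2
    · rintro u v huv ⟨hu, hr⟩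
      refine ⟨huv.2.2, hr.trans ?_⟩
      exact (leaperGraph_adj_iff.2 huv : (leaperGraph p q).Adj ⟨u, hu⟩ ⟨v, huv.2.2⟩).reachable

lemma isCycles_leaperGraph {p q : ℕ} (hp : 0 < p) (hpq : p < q) (hodd : Odd (p + q)) :
    (leaperGraph p q).IsCycles := by
  rintro v ⟨w, hw⟩
  rw [← ncard_neighborSet_boardGraph hp hpq hodd
    (mem_frame_of_adj hpq hodd (leaperGraph_adj_iff.1 hw)),
    ← Set.ncard_image_of_injective _ Subtype.val_injective]
  congr 1
  ext t
  constructor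
  · rintro ⟨u, hu, rfl⟩
    exact leaperGraph_adj_iff.1 hu
  · intro h
    have h' : (boardGraph p q).Adj v t := h
    exact ⟨⟨t, h'.2.2⟩, leaperGraph_adj_iff.2 h', rfl⟩

/-- Each vertex of a cycle already has both of its neighbours on the cycle, so the support is closed
under adjacency. -/
lemma squares_eq_comp {p q : ℕ} (hp : 0 < p) (hpq : p < q) (hodd : Odd (p + q))
    {a : board (p + q)} {C : (leaperGraph p q).Walk a a} (hC : C.IsCycle) :
    squares C = comp p q a ∧ a.1 ∈ frame p q := by
  have : Finite (board (p + q)) := finite_board _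
  have hcl : ∀ u v, (leaperGraph p q).Adj u v → u ∈ C.support → v ∈ C.support := by
    intro u v huv hu
    have : (leaperGraph p q).LocallyFinite := fun _ => Fintype.ofFinite _
    have := (hC.adj_toSubgraph_iff_of_isCycles (isCycles_leaperGraph hp hpq hodd)
      (C.mem_verts_toSubgraph.2 hu) v).2 huv
    exact C.mem_verts_toSubgraph.1 this.snd_mem
  constructor
  · ext t
    constructor
    · rintro ⟨u, hu, rfl⟩
      exact reachable_leaperGraph_iff.1 ⟨C.takeUntil u hu⟩
    · intro h
      refine comp_induction (P := fun t => t ∈ squares C) h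
        ⟨a, C.start_mem_support, rfl⟩ fun u v huv hu => ?_
      obtain ⟨u', hu', rfl⟩ := hu
      exact ⟨⟨v, huv.2.2⟩, hcl _ _ (leaperGraph_adj_iff.2 huv) hu', rfl⟩
  · cases C with
    | nil => exact absurd hC SimpleGraph.Walk.not_isCycle_nil
    | cons h _ => exact mem_frame_of_adj hpq hodd (leaperGraph_adj_iff.1 h)

lemma isCycleSet_comp {p q : ℕ} (hp : 0 < p) (hpq : p < q) (hodd : Odd (p + q)) {s : ℤ × ℤ}
    (hs : s ∈ frame p q) : IsCycleSet p q (comp p q s) := by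
  have : Finite (board (p + q)) := finite_board _
  have hb := frame_subset_board hpq hodd hs
  have hne : ((boardGraph p q).neighborSet s).Nonempty := by
    apply Set.nonempty_of_ncard_ne_zero
    rw [ncard_neighborSet_boardGraph hp hpq hodd hs]
    norm_num
  obtain ⟨t, ht⟩ := hne
  have ht' : (boardGraph p q).Adj s t := ht
  obtain ⟨C, hC, -⟩ :=
    (isCycles_leaperGraph hp hpq hodd).exists_cycle_toSubgraph_verts_eq_connectedComponentSupp
    (c := (leaperGraph p q).connectedComponentMk ⟨s, hb⟩) (v := ⟨s, hb⟩) rfl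
    ⟨⟨t, ht'.2.2⟩, leaperGraph_adj_iff.2 ht'⟩
  exact ⟨_, C, hC, (squares_eq_comp hp hpq hodd hC).1⟩

lemma isCycleSet_iff {p q : ℕ} (hp : 0 < p) (hpq : p < q) (hodd : Odd (p + q))
    {S : Set (ℤ × ℤ)} : IsCycleSet p q S ↔ ∃ s ∈ frame p q, S = comp p q s := by
  constructor
  · rintro ⟨a, C, hC, rfl⟩
    obtain ⟨h1, h2⟩ := squares_eq_comp hp hpq hodd hC
    exact ⟨a, h2, h1⟩
  · rintro ⟨s, hs, rfl⟩
    exact isCycleSet_comp hp hpq hodd hs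

lemma length_eq_ncard_squares {p q : ℕ} {a : board (p + q)} {C : (leaperGraph p q).Walk a a}
    (hC : C.IsCycle) : C.length = (squares C).ncard := by
  classical
  have h : squares C = Subtype.val '' (C.support.tail.toFinset : Set (board (p + q))) := by
    unfold squares
    congr 1
    ext v
    simp only [Set.mem_ofPred_eq, List.coe_toFinset]
    refine ⟨fun hv => ?_, List.mem_of_mem_tail⟩
    cases C with
    | nil => exact absurd hC SimpleGraph.Walk.not_isCycle_nil
    | cons hadj w =>
      rw [SimpleGraph.Walk.support_cons] at hv ⊢
      rcases List.mem_cons.1 hv with rfl | hv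
      · exact w.end_mem_support
      · exact hv
  rw [h, Set.ncard_image_of_injective _ Subtype.val_injective, Set.ncard_coe_finset,
    List.toFinset_card_of_nodup hC.support_nodup, List.length_tail, C.length_support]
  rfl

/-! ### Lifting, uniformly for `f`, `g` and `h` -/

/-- The square `s` of the `(p, q)`-frame is carried by its section to the square `u`. -/
def Lifts (p q : ℕ) (s u : ℤ × ℤ) : Prop :=
  ∃ d : SignType × SignType, d ≠ 0 ∧
    s ∈ frameSection p q d ∧ s - dirVector ((q : ℤ) - p) p d = u

lemma mem_lift_iff {p q : ℕ} {S : Set (ℤ × ℤ)} {s : ℤ × ℤ} :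
    s ∈ lift p q ((q : ℤ) - p) p S ↔ ∃ u ∈ S, Lifts p q s u := by
  constructor
  · rintro ⟨d, h0, h1, h2⟩
    exact ⟨_, h2, d, h0, h1, rfl⟩
  · rintro ⟨u, hu, d, h0, h1, rfl⟩
    exact ⟨d, h0, h1, hu⟩

/-- In terms of the larger (p, q)-frame, the vectors of f, g and h all have lengths q - p (sides)
and p (corners). This allows a uniform treatment. -/
lemma liftF_eq (m n : ℕ) (S : Set (ℤ × ℤ)) :
    liftF m n S = lift m (2 * m + n) (((2 * m + n : ℕ) : ℤ) - m) m S := by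
  unfold liftF; congr 1; push_cast; ring

lemma liftG_eq {m n : ℕ} (h : m < n) (S : Set (ℤ × ℤ)) :
    liftG m n S = lift n (2 * n - m) (((2 * n - m : ℕ) : ℤ) - n) n S := by
  unfold liftG; congr 1; omega

lemma liftH_eq (m n : ℕ) (S : Set (ℤ × ℤ)) :
    liftH m n S = lift n (m + 2 * n) (((m + 2 * n : ℕ) : ℤ) - n) n S := by
  unfold liftH; congr 1; push_cast; ring

lemma dirVector_E (a b : ℤ) : dirVector a b (1, 0) = (a, 0) := by simp [dirVector]
lemma dirVector_NE (a b : ℤ) : dirVector a b (1, 1) = (b, b) := by simp [dirVector]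
lemma dirVector_N (a b : ℤ) : dirVector a b (0, 1) = (0, a) := by simp [dirVector]
lemma dirVector_NW (a b : ℤ) : dirVector a b (-1, 1) = (-b, b) := by simp [dirVector]
lemma dirVector_W (a b : ℤ) : dirVector a b (-1, 0) = (-a, 0) := by simp [dirVector]
lemma dirVector_SW (a b : ℤ) : dirVector a b (-1, -1) = (-b, -b) := by simp [dirVector]
lemma dirVector_S (a b : ℤ) : dirVector a b (0, -1) = (0, -a) := by simp [dirVector]
lemma dirVector_SE (a b : ℤ) : dirVector a b (1, -1) = (b, -b) := by simp [dirVector]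

lemma lifts_iff {p q : ℕ} {x y z w : ℤ} : Lifts p q (x, y) (z, w) ↔
    ((((q : ℤ) - p < 2 * x ∧ 2 * x < p + q) ∧ -((q : ℤ) - p) < 2 * y ∧ 2 * y < (q : ℤ) - p) ∧
      x = z + q - p ∧ y = w) ∨
    ((((q : ℤ) - p < 2 * x ∧ 2 * x < p + q) ∧ (q : ℤ) - p < 2 * y ∧ 2 * y < (p : ℤ) + q) ∧
      x = z + p ∧ y = w + p) ∨
    (((-((q : ℤ) - p) < 2 * x ∧ 2 * x < (q : ℤ) - p) ∧ (q : ℤ) - p < 2 * y ∧ 2 * y < p + q) ∧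
      x = z ∧ y = w + q - p) ∨
    (((-((p : ℤ) + q) < 2 * x ∧ 2 * x < -((q : ℤ) - p)) ∧ (q : ℤ) - p < 2 * y ∧
      2 * y < (p : ℤ) + q) ∧ x = z - p ∧ y = w + p) ∨
    (((-((p : ℤ) + q) < 2 * x ∧ 2 * x < -((q : ℤ) - p)) ∧ -((q : ℤ) - p) < 2 * y ∧
      2 * y < (q : ℤ) - p) ∧ x = z - q + p ∧ y = w) ∨
    (((-((p : ℤ) + q) < 2 * x ∧ 2 * x < -((q : ℤ) - p)) ∧ -((p : ℤ) + q) < 2 * y ∧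
      2 * y < -((q : ℤ) - p)) ∧ x = z - p ∧ y = w - p) ∨
    (((-((q : ℤ) - p) < 2 * x ∧ 2 * x < (q : ℤ) - p) ∧ -((p : ℤ) + q) < 2 * y ∧
      2 * y < -((q : ℤ) - p)) ∧ x = z ∧ y = w - q + p) ∨
    ((((q : ℤ) - p < 2 * x ∧ 2 * x < p + q) ∧ -((p : ℤ) + q) < 2 * y ∧
      2 * y < -((q : ℤ) - p)) ∧ x = z + p ∧ y = w - p) := by
  simp only [Lifts, exists_dir_iff, frameSection, Set.mem_ofPred_eq, inBand_neg, inBand_zero,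
    inBand_one, dirVector_E, dirVector_NE, dirVector_N, dirVector_NW, dirVector_W, dirVector_SW,
    dirVector_S, dirVector_SE, Prod.mk_sub_mk, Prod.mk.injEq]
  refine or_congr ?_ (or_congr ?_ (or_congr ?_ (or_congr ?_ (or_congr ?_ (or_congr ?_
    (or_congr ?_ ?_)))))) <;> omega

/-! Throughout, `m = |q - 2p|`: the `(p, q)`-frame is lifted from the board of the leaper with moves
`p` and `m`. -/

lemma Lifts.right_unique {p q : ℕ} (hpq : p < q) {s u v : ℤ × ℤ} (hu : Lifts p q s u) (hv : Lifts p q s v) :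
    u = v := by
  obtain ⟨x, y⟩ := s
  obtain ⟨z, w⟩ := u
  obtain ⟨z', w'⟩ := v
  rw [lifts_iff] at hu hv
  rw [Prod.mk.injEq]
  rcases hu with h | h | h | h | h | h | h | h <;> omega

lemma Lifts.mem_board {p q m : ℕ} (hm : 2 * p + m = q ∨ q + m = 2 * p)
    {s u : ℤ × ℤ} (h : Lifts p q s u) : u ∈ board (m + p) := by
  obtain ⟨x, y⟩ := s
  obtain ⟨z, w⟩ := u
  rw [lifts_iff] at h
  rw [mem_board_iff]
  rcases h with h | h | h | h | h | h | h | h <;> omega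

/-- This lemma and the next seven describe lifting from below, by conditions on the image. Their
order is the octagon order: squares over the same (z, w) given by consecutive lemmas differ by a (p,
q)-move, and so do the last and the first. -/
lemma lifts_NE {p q : ℕ} {z w : ℤ} (h1 : ((q : ℤ) - 3 * p < 2 * z ∧ 2 * z < (q : ℤ) - p))
    (h2 : ((q : ℤ) - 3 * p < 2 * w ∧ 2 * w < (q : ℤ) - p)) :
    Lifts p q (z + p, w + p) (z, w) :=
  lifts_iff.2 (.inr (.inl ⟨by omega, by omega, by omega⟩))

lemma lifts_S {p q : ℕ} {z w : ℤ} (h1 : (-((q : ℤ) - p) < 2 * z ∧ 2 * z < (q : ℤ) - p))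
    (h2 : ((q : ℤ) - 3 * p < 2 * w ∧ 2 * w < (q : ℤ) - p)) :
    Lifts p q (z, w - (q - p)) (z, w) :=
  lifts_iff.2 (.inr (.inr (.inr (.inr (.inr (.inr (.inl ⟨by omega, by omega, by omega⟩)))))))

lemma lifts_NW {p q : ℕ} {z w : ℤ} (h1 : (-((q : ℤ) - p) < 2 * z ∧ 2 * z < 3 * (p : ℤ) - q))
    (h2 : ((q : ℤ) - 3 * p < 2 * w ∧ 2 * w < (q : ℤ) - p)) :
    Lifts p q (z - p, w + p) (z, w) :=
  lifts_iff.2 (.inr (.inr (.inr (.inl ⟨by omega, by omega, by omega⟩))))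

lemma lifts_E {p q : ℕ} {z w : ℤ} (h1 : (-((q : ℤ) - p) < 2 * z ∧ 2 * z < 3 * (p : ℤ) - q))
    (h2 : (-((q : ℤ) - p) < 2 * w ∧ 2 * w < (q : ℤ) - p)) :
    Lifts p q (z + (q - p), w) (z, w) :=
  lifts_iff.2 (.inl ⟨by omega, by omega, by omega⟩)

lemma lifts_SW {p q : ℕ} {z w : ℤ} (h1 : (-((q : ℤ) - p) < 2 * z ∧ 2 * z < 3 * (p : ℤ) - q))
    (h2 : (-((q : ℤ) - p) < 2 * w ∧ 2 * w < 3 * (p : ℤ) - q)) :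
    Lifts p q (z - p, w - p) (z, w) :=
  lifts_iff.2 (.inr (.inr (.inr (.inr (.inr (.inl ⟨by omega, by omega, by omega⟩))))))

lemma lifts_N {p q : ℕ} {z w : ℤ} (h1 : (-((q : ℤ) - p) < 2 * z ∧ 2 * z < (q : ℤ) - p))
    (h2 : (-((q : ℤ) - p) < 2 * w ∧ 2 * w < 3 * (p : ℤ) - q)) :
    Lifts p q (z, w + (q - p)) (z, w) :=
  lifts_iff.2 (.inr (.inr (.inl ⟨by omega, by omega, by omega⟩)))

lemma lifts_SE {p q : ℕ} {z w : ℤ} (h1 : ((q : ℤ) - 3 * p < 2 * z ∧ 2 * z < (q : ℤ) - p))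
    (h2 : (-((q : ℤ) - p) < 2 * w ∧ 2 * w < 3 * (p : ℤ) - q)) :
    Lifts p q (z + p, w - p) (z, w) :=
  lifts_iff.2 (.inr (.inr (.inr (.inr (.inr (.inr (.inr ⟨by omega, by omega, by omega⟩)))))))

lemma lifts_W {p q : ℕ} {z w : ℤ} (h1 : ((q : ℤ) - 3 * p < 2 * z ∧ 2 * z < (q : ℤ) - p))
    (h2 : (-((q : ℤ) - p) < 2 * w ∧ 2 * w < (q : ℤ) - p)) :
    Lifts p q (z - (q - p), w) (z, w) :=
  lifts_iff.2 (.inr (.inr (.inr (.inr (.inl ⟨by omega, by omega, by omega⟩)))))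

/-- A move joins either neighbours in the octagon order, which have the same image, or opposite
sections. In the latter case the displacement changes by twice the section vector: between sides q
becomes ±(q - 2p) and p is kept; between corners q becomes ±(q - 2p) and p changes sign. -/
lemma Lifts.eq_or_adj {p q m : ℕ} (hp : 0 < p) (hpq : p < q)
    (hm : 2 * p + m = q ∨ q + m = 2 * p)
    {s t u v : ℤ × ℤ} (hst : (boardGraph p q).Adj s t) (hu : Lifts p q s u) (hv : Lifts p q t v) :
    u = v ∨ (boardGraph m p).Adj u v := by
  obtain ⟨x, y⟩ := s
  obtain ⟨x', y'⟩ := t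
  have hbu := hu.mem_board hm
  have hbv := hv.mem_board hm
  obtain ⟨z, w⟩ := u
  obtain ⟨z', w'⟩ := v
  rw [boardGraph_adj_iff (by omega)] at hst
  rw [lifts_iff] at hu hv
  rw [mem_board_iff] at hbu hbv
  rw [Prod.mk.injEq, boardGraph_adj_iff hp]
  rcases hst with ⟨⟨h1 | h1, h2 | h2⟩ | ⟨h1 | h1, h2 | h2⟩, -, h4⟩ <;>
    rcases hu with h | h | h | h | h | h | h | h <;>
    first
    | (exfalso; clear hv hbu hbv; omega)
    | (rcases hv with h' | h' | h' | h' | h' | h' | h' | h' <;>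
        first
        | (exfalso; clear hbu hbv; omega)
        | exact Or.inl ⟨by omega, by omega⟩
        | exact Or.inr ⟨Or.inl ⟨by omega, by omega⟩, hbu, hbv⟩
        | exact Or.inr ⟨Or.inr ⟨by omega, by omega⟩, hbu, hbv⟩)

lemma exists_lifts_of_adj {p q m : ℕ} (hp : 0 < p) (hpq : p < q)
    (hm : 2 * p + m = q ∨ q + m = 2 * p)
    {u v : ℤ × ℤ} (huv : (boardGraph m p).Adj u v) :
    ∃ s t, Lifts p q s u ∧ Lifts p q t v ∧ (boardGraph p q).Adj s t := by
  obtain ⟨z, w⟩ := u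
  obtain ⟨z', w'⟩ := v
  rw [boardGraph_adj_iff hp] at huv
  have key : ∀ x y x' y', Lifts p q (x, y) (z, w) → Lifts p q (x', y') (z', w') →
      (((x' = x + p ∨ x' = x - p) ∧ (y' = y + q ∨ y' = y - q)) ∨
        ((x' = x + q ∨ x' = x - q) ∧ (y' = y + p ∨ y' = y - p))) →
      ∃ s t, Lifts p q s (z, w) ∧ Lifts p q t (z', w') ∧ (boardGraph p q).Adj s t := by
    intro x y x' y' h1 h2 h3
    refine ⟨_, _, h1, h2, (boardGraph_adj_iff (hp.trans hpq)).2 ⟨h3, ?_, ?_⟩⟩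
    · rw [lifts_iff] at h1; clear h2 h3 huv; omega
    · rw [lifts_iff] at h2; clear h1 h3 huv; omega
  -- For q = 2p + m the pairs E–W and N–S serve; for q = 2p - m the pairs of opposite corners.
  rcases hm with hm | hm <;>
    rcases huv with ⟨⟨h1 | h1, h2 | h2⟩ | ⟨h1 | h1, h2 | h2⟩, hb⟩ <;>
    first
    | exact key _ _ _ _ (lifts_E (by omega) (by omega)) (lifts_W (by omega) (by omega)) (by omega)
    | exact key _ _ _ _ (lifts_W (by omega) (by omega)) (lifts_E (by omega) (by omega)) (by omega)
    | exact key _ _ _ _ (lifts_N (by omega) (by omega)) (lifts_S (by omega) (by omega)) (by omega)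
    | exact key _ _ _ _ (lifts_S (by omega) (by omega)) (lifts_N (by omega) (by omega)) (by omega)
    | exact key _ _ _ _ (lifts_NE (by omega) (by omega)) (lifts_SW (by omega) (by omega)) (by omega)
    | exact key _ _ _ _ (lifts_SW (by omega) (by omega)) (lifts_NE (by omega) (by omega)) (by omega)
    | exact key _ _ _ _ (lifts_NW (by omega) (by omega)) (lifts_SE (by omega) (by omega)) (by omega)
    | exact key _ _ _ _ (lifts_SE (by omega) (by omega)) (lifts_NW (by omega) (by omega)) (by omega)

/-- The propositional core of the connectedness of fibres. A section is occupied when its two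
coordinate conditions hold; `h` forces the occupied ones to form an arc of the octagon, so labels
which agree on occupied neighbours agree throughout. The suffixes M, P and 0 mean that the
coordinate admits a lift by +p, by -p, or into the middle band. -/
lemma exists_forall_eq_of_cyclic {α : Type*} {cNE cS cNW cE cSW cN cSE cW : α}
    {z0 zM zP w0 wM wP : Prop}
    (h : ((zM → z0) ∧ (zP → z0) ∧ (wM → w0) ∧ (wP → w0) ∧
        ((¬(zM ∧ zP) ∧ ¬(wM ∧ wP)) ∨ ((zM ∨ zP) ∧ (wM ∨ wP)))) ∨
      ((z0 ↔ zM ∧ zP) ∧ (w0 ↔ wM ∧ wP)))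
    (h0 : zM → wM → z0 → cNE = cS)
    (h1 : z0 → wM → zP → cS = cNW)
    (h2 : zP → wM → w0 → cNW = cE)
    (h3 : zP → w0 → wP → cE = cSW)
    (h4 : zP → wP → z0 → cSW = cN)
    (h5 : z0 → wP → zM → cN = cSE)
    (h6 : zM → wP → w0 → cSE = cW)
    (h7 : zM → w0 → wM → cW = cNE) :
    ∃ γ, (zM → wM → cNE = γ) ∧
      (z0 → wM → cS = γ) ∧
      (zP → wM → cNW = γ) ∧
      (zP → w0 → cE = γ) ∧
      (zP → wP → cSW = γ) ∧
      (z0 → wP → cN = γ) ∧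
      (zM → wP → cSE = γ) ∧
      (zM → w0 → cW = γ) := by
  by_cases a1 : zM <;> by_cases a2 : zP <;> by_cases b1 : wM <;> by_cases b2 : wP <;>
    by_cases a0 : z0 <;> by_cases b0 : w0 <;>
    simp only [a0, a1, a2, b0, b1, b2, true_implies, false_implies, true_and, and_true, not_true,
      not_false_iff, or_true, or_false, and_false, or_self, iff_true,
      iff_false, iff_self, implies_true, and_self] at h h0 h1 h2 h3 h4 h5 h6 h7 ⊢ <;>
    solve
    | (refine ⟨cNE, ?_⟩; simp_all)
    | (refine ⟨cS, ?_⟩; simp_all)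
    | (refine ⟨cW, ?_⟩; simp_all)
    | (refine ⟨cE, ?_⟩; simp_all)
    | (refine ⟨cN, ?_⟩; simp_all)
    | (refine ⟨cNW, ?_⟩; simp_all)
    | (refine ⟨cSE, ?_⟩; simp_all)
    | (refine ⟨cSW, ?_⟩; simp_all)

lemma reachable_of_lifts {p q m : ℕ} (hp : 0 < p) (hpq : p < q)
    (hm : 2 * p + m = q ∨ q + m = 2 * p) (hodd : Odd (p + q))
    {s t u : ℤ × ℤ} (hs : Lifts p q s u) (ht : Lifts p q t u) : (boardGraph p q).Reachable s t := by
  obtain ⟨z, w⟩ := u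
  have hb := hs.mem_board hm
  rw [mem_board_iff] at hb
  obtain ⟨k, hk⟩ := hodd
  -- The labels are connected components, so that equal labels mean reachability.
  let c : ℤ → ℤ → (boardGraph p q).ConnectedComponent :=
    fun x y => (boardGraph p q).connectedComponentMk (x, y)
  have adj : ∀ {x y x' y'}, Lifts p q (x, y) (z, w) → Lifts p q (x', y') (z, w) →
      (((x' = x + p ∨ x' = x - p) ∧ (y' = y + q ∨ y' = y - q)) ∨
        ((x' = x + q ∨ x' = x - q) ∧ (y' = y + p ∨ y' = y - p))) → c x y = c x' y' := by
    intro x y x' y' h1 h2 h3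
    refine SimpleGraph.ConnectedComponent.sound
      ((boardGraph_adj_iff (hp.trans hpq)).2 ⟨h3, ?_, ?_⟩).reachable
    · rw [lifts_iff] at h1; clear h2 h3 hb hs ht; omega
    · rw [lifts_iff] at h2; clear h1 h3 hb hs ht; omega
  obtain ⟨γ, gNE, gS, gNW, gE, gSW, gN, gSE, gW⟩ := exists_forall_eq_of_cyclic
    (z0 := -((q : ℤ) - p) < 2 * z ∧ 2 * z < (q : ℤ) - p)
    (zM := (q : ℤ) - 3 * p < 2 * z ∧ 2 * z < (q : ℤ) - p)
    (zP := -((q : ℤ) - p) < 2 * z ∧ 2 * z < 3 * (p : ℤ) - q)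
    (w0 := -((q : ℤ) - p) < 2 * w ∧ 2 * w < (q : ℤ) - p)
    (wM := (q : ℤ) - 3 * p < 2 * w ∧ 2 * w < (q : ℤ) - p)
    (wP := -((q : ℤ) - p) < 2 * w ∧ 2 * w < 3 * (p : ℤ) - q)
    (cNE := c (z + p) (w + p))
    (cS := c (z) (w - (q - p)))
    (cNW := c (z - p) (w + p))
    (cE := c (z + (q - p)) (w))
    (cSW := c (z - p) (w - p))
    (cN := c (z) (w + (q - p)))
    (cSE := c (z + p) (w - p))
    (cW := c (z - (q - p)) (w))
    (by
      clear adj hs ht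
      -- The conditions by ±p are disjoint when q > 3p and jointly cover the board when q < 3p; when
      -- q ≤ 2p the middle condition is their conjunction.
      rcases hm with hm | hm
      · refine .inl ⟨by omega, by omega, by omega, by omega, ?_⟩
        rcases le_or_gt q (3 * p) with h | h
        · exact .inr ⟨by omega, by omega⟩
        · exact .inl ⟨by omega, by omega⟩
      · exact .inr ⟨by omega, by omega⟩)
    (fun zM wM z0 => adj (lifts_NE zM wM) (lifts_S z0 wM) (by omega))
    (fun z0 wM zP => adj (lifts_S z0 wM) (lifts_NW zP wM) (by omega))
    (fun zP wM w0 => adj (lifts_NW zP wM) (lifts_E zP w0) (by omega))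
    (fun zP w0 wP => adj (lifts_E zP w0) (lifts_SW zP wP) (by omega))
    (fun zP wP z0 => adj (lifts_SW zP wP) (lifts_N z0 wP) (by omega))
    (fun z0 wP zM => adj (lifts_N z0 wP) (lifts_SE zM wP) (by omega))
    (fun zM wP w0 => adj (lifts_SE zM wP) (lifts_W zM w0) (by omega))
    (fun zM w0 wM => adj (lifts_W zM w0) (lifts_NE zM wM) (by omega))
  have key : ∀ r, Lifts p q r (z, w) → c r.1 r.2 = γ := by
    rintro ⟨x, y⟩ hr
    rw [lifts_iff] at hr
    rcases hr with ⟨h, rfl, rfl⟩ | ⟨h, rfl, rfl⟩ | ⟨h, rfl, rfl⟩ | ⟨h, rfl, rfl⟩ | ⟨h, rfl, rfl⟩ |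
      ⟨h, rfl, rfl⟩ | ⟨h, rfl, rfl⟩ | ⟨h, rfl, rfl⟩
    · rw [← gE (by omega) (by omega)]; congr 1; ring
    · rw [← gNE (by omega) (by omega)]
    · rw [← gN (by omega) (by omega)]; congr 1; ring
    · rw [← gNW (by omega) (by omega)]
    · rw [← gW (by omega) (by omega)]; congr 1; ring
    · rw [← gSW (by omega) (by omega)]
    · rw [← gS (by omega) (by omega)]; congr 1; ring
    · rw [← gSE (by omega) (by omega)]
  exact SimpleGraph.ConnectedComponent.exact ((key s hs).trans (key t ht).symm)

/-- Projecting a path gives one inclusion. For the other, each edge below has some lift, and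
connected fibres glue the lifted edges together. No order between m and p is assumed, so this covers
f, g and h. -/
lemma comp_eq_lift {p q m : ℕ} (hp : 0 < p) (hpq : p < q)
    (hm : 2 * p + m = q ∨ q + m = 2 * p) (hodd : Odd (p + q)) {s u : ℤ × ℤ} (hs : Lifts p q s u) :
    comp p q s = lift p q ((q : ℤ) - p) p (comp m p u) := by
  ext t
  rw [mem_lift_iff]
  constructor
  · intro ht
    refine comp_induction (P := fun t => ∃ v ∈ comp m p u, Lifts p q t v) ht
      ⟨u, self_mem_comp _ _ _, hs⟩ ?_
    rintro a b hab ⟨v, hv, hav⟩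
    obtain ⟨d, h0, h1⟩ := mem_frame_of_adj hpq hodd hab.symm
    have hb : Lifts p q b _ := ⟨d, h0, h1, rfl⟩
    refine ⟨_, ?_, hb⟩
    rcases hav.eq_or_adj hp hpq hm hab hb with h | h
    · exact h ▸ hv
    · exact SimpleGraph.Reachable.trans hv h.reachable
  · rintro ⟨v, hv, ht⟩
    revert t
    refine comp_induction (P := fun v => ∀ t, Lifts p q t v → t ∈ comp p q s) hv
      (fun t ht => reachable_of_lifts hp hpq hm hodd hs ht) ?_
    intro a b hab ih t ht
    obtain ⟨s', t', hs', ht', hadj⟩ := exists_lifts_of_adj hp hpq hm hab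
    exact ((ih s' hs').trans hadj.reachable).trans (reachable_of_lifts hp hpq hm hodd ht' ht)

/-! ### Lifts of the squares of the smaller board -/

lemma Lifts.mem_frame_left {p q : ℕ} {s u : ℤ × ℤ} (h : Lifts p q s u) : s ∈ frame p q := by
  obtain ⟨d, h0, h1, -⟩ := h
  exact ⟨d, h0, h1⟩

lemma exists_lifts_of_mem_frame {p q : ℕ} {s : ℤ × ℤ} (h : s ∈ frame p q) : ∃ u, Lifts p q s u := by
  obtain ⟨d, h0, h1⟩ := h
  exact ⟨_, d, h0, h1, rfl⟩

/-- Under f nothing lies over the central hole, so no new cycles are born. -/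
lemma Lifts.mem_frame_of_lt {p m : ℕ} (hpm : p < m) (hodd : Odd (p + m))
    {s u : ℤ × ℤ} (h : Lifts p (2 * p + m) s u) : u ∈ frame p m := by
  obtain ⟨x, y⟩ := s
  obtain ⟨z, w⟩ := u
  rw [lifts_iff] at h
  rw [mem_frame_iff hpm hodd, mem_board_iff]
  rcases h with h | h | h | h | h | h | h | h <;> omega

lemma exists_lifts_of_lt {p m : ℕ} {u : ℤ × ℤ}
    (hu : u ∈ frame p m) : ∃ s, Lifts p (2 * p + m) s u := by
  obtain ⟨z, w⟩ := u
  simp only [frame, Set.mem_ofPred_eq, exists_dir_iff, frameSection, inBand_neg, inBand_zero,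
    inBand_one] at hu
  rcases hu with h | h | h | h | h | h | h | h
  · exact ⟨_, lifts_W (by omega) (by omega)⟩
  · exact ⟨_, lifts_NE (by omega) (by omega)⟩
  · exact ⟨_, lifts_S (by omega) (by omega)⟩
  · exact ⟨_, lifts_NW (by omega) (by omega)⟩
  · exact ⟨_, lifts_E (by omega) (by omega)⟩
  · exact ⟨_, lifts_SW (by omega) (by omega)⟩
  · exact ⟨_, lifts_N (by omega) (by omega)⟩
  · exact ⟨_, lifts_SE (by omega) (by omega)⟩

/-- Under g and h every square of the smaller board, the hole included, has a lift. A corner section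
chosen by the signs of the coordinates already works. -/
lemma exists_lifts_of_gt {p q m : ℕ} (hm : 2 * p + m = q ∨ q + m = 2 * p) (hmp : m < p)
    {u : ℤ × ℤ} (hu : u ∈ board (m + p)) : ∃ s, Lifts p q s u := by
  obtain ⟨z, w⟩ := u
  rw [mem_board_iff] at hu
  rcases hm with hm | hm
  · rcases le_or_gt 0 z with h1 | h1 <;> rcases le_or_gt 0 w with h2 | h2
    · exact ⟨_, lifts_NE (by omega) (by omega)⟩
    · exact ⟨_, lifts_SE (by omega) (by omega)⟩
    · exact ⟨_, lifts_NW (by omega) (by omega)⟩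
    · exact ⟨_, lifts_SW (by omega) (by omega)⟩
  · rcases le_or_gt 0 z with h1 | h1 <;> rcases le_or_gt 0 w with h2 | h2
    · exact ⟨_, lifts_SW (by omega) (by omega)⟩
    · exact ⟨_, lifts_NW (by omega) (by omega)⟩
    · exact ⟨_, lifts_SE (by omega) (by omega)⟩
    · exact ⟨_, lifts_NE (by omega) (by omega)⟩

/-! ### The shell consists of the lifts of the central hole -/

lemma inSpan_zero {mid lo hi x : ℤ} : InSpan mid lo hi 0 x ↔ -mid < 2 * x ∧ 2 * x < mid := by
  rw [InSpan, if_pos rfl, abs_lt]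

lemma inSpan_one {mid lo hi x : ℤ} : InSpan mid lo hi 1 x ↔ lo < 2 * x ∧ 2 * x < hi := by
  simp [InSpan]

lemma inSpan_neg {mid lo hi x : ℤ} : InSpan mid lo hi (-1) x ↔ lo < -(2 * x) ∧ -(2 * x) < hi := by
  simp [InSpan]

/-- The subboards of the shell have side p - m in both cases of its definition: they are the eight
translates of the central hole of the (m, p)-frame. -/
lemma Lifts.mem_shell_iff {p q m : ℕ} (hpq : p < q) (hm : 2 * p + m = q ∨ q + m = 2 * p)
    (hmp : m < p) {s : ℤ × ℤ} {z w : ℤ} (h : Lifts p q s (z, w)) :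
    s ∈ shell p q ↔ (-((p : ℤ) - m) < 2 * z ∧ 2 * z < (p : ℤ) - m) ∧
      -((p : ℤ) - m) < 2 * w ∧ 2 * w < (p : ℤ) - m := by
  obtain ⟨x, y⟩ := s
  simp only [shell, Set.mem_ofPred_eq, exists_dir_iff]
  rw [lifts_iff] at h
  have e1 : (1 : SignType) ≠ 0 := by decide
  have e2 : (-1 : SignType) ≠ 0 := by decide
  simp only [e1, e2, or_true, true_or, or_self, if_true, if_false, inSpan_zero, inSpan_one,
    inSpan_neg]
  by_cases h1 : q ≤ 2 * p
  all_goals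
    simp only [h1, if_true, if_false]
    constructor
    · intro h'
      rcases h with h | h | h | h | h | h | h | h <;>
        rcases h' with h' | h' | h' | h' | h' | h' | h' | h' <;> omega
    · intro h'
      rcases h with h | h | h | h | h | h | h | h
      · exact .inl ⟨by omega, by omega⟩
      · exact .inr (.inl ⟨by omega, by omega⟩)
      · exact .inr (.inr (.inl ⟨by omega, by omega⟩))
      · exact .inr (.inr (.inr (.inl ⟨by omega, by omega⟩)))
      · exact .inr (.inr (.inr (.inr (.inl ⟨by omega, by omega⟩))))
      · exact .inr (.inr (.inr (.inr (.inr (.inl ⟨by omega, by omega⟩)))))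
      · exact .inr (.inr (.inr (.inr (.inr (.inr (.inl ⟨by omega, by omega⟩))))))
      · exact .inr (.inr (.inr (.inr (.inr (.inr (.inr ⟨by omega, by omega⟩))))))

/-! ### Counting squares -/

/-- The directions of the corner sections. -/
def cornerDirs : Finset (SignType × SignType) := {(1, 1), (-1, 1), (-1, -1), (1, -1)}

/-- The directions of the side sections. -/
def sideDirs : Finset (SignType × SignType) := {(1, 0), (0, 1), (-1, 0), (0, -1)}

/-- The union of the sections in the directions of `D`. -/
def region (p q : ℕ) (D : Finset (SignType × SignType)) : Set (ℤ × ℤ) :=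
  {s | ∃ d ∈ D, s ∈ frameSection p q d}

lemma InBand.unique {p q : ℕ} (hpq : p < q) {d e : SignType} {x : ℤ} (hd : InBand p q d x)
    (he : InBand p q e x) : d = e := by
  cases d <;> cases e <;>
    simp only [SignType.zero_eq_zero, SignType.neg_eq_neg_one, SignType.pos_eq_one, inBand_zero,
      inBand_one, inBand_neg] at hd he ⊢ <;> omega

lemma frameSection_unique {p q : ℕ} (hpq : p < q) {d e : SignType × SignType} {s : ℤ × ℤ}
    (hd : s ∈ frameSection p q d) (he : s ∈ frameSection p q e) : d = e :=
  Prod.ext (hd.1.unique hpq he.1) (hd.2.unique hpq he.2)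

-- A lifted square determines its section, hence its preimage, so lifted squares correspond to pairs
-- (u, d).
open Classical in
lemma ncard_lift_inter_region {p q : ℕ} (hpq : p < q) (a b : ℤ) (T : Finset (ℤ × ℤ))
    (D : Finset (SignType × SignType)) (hD : (0 : SignType × SignType) ∉ D) :
    (lift p q a b T ∩ region p q D).ncard =
      ∑ u ∈ T, (D.filter fun d => u + dirVector a b d ∈ frameSection p q d).card := by
  rw [← Finset.card_sigma]
  have : lift p q a b T ∩ region p q D = ((T.sigma fun u => D.filter fun d =>
      u + dirVector a b d ∈ frameSection p q d).image
        (fun x => x.1 + dirVector a b x.2) : Finset (ℤ × ℤ)) := by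
    ext s
    simp only [Finset.coe_image, Set.mem_image, Finset.mem_coe, Finset.mem_sigma,
      Finset.mem_filter, Sigma.exists]
    constructor
    · rintro ⟨⟨d, h0, h1, h2⟩, e, he, h3⟩
      obtain rfl := frameSection_unique hpq h1 h3
      exact ⟨s - dirVector a b d, d, ⟨h2, he, by rwa [sub_add_cancel]⟩, sub_add_cancel _ _⟩
    · rintro ⟨u, d, ⟨hu, hd, h⟩, rfl⟩
      exact ⟨⟨d, fun h0 => hD (h0 ▸ hd), h, by rwa [add_sub_cancel_right]⟩, d, hd, h⟩
  rw [this, Set.ncard_coe_finset, Finset.card_image_of_injOn]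
  rintro ⟨u, d⟩ hx ⟨v, e⟩ hy h
  simp only [Finset.coe_sigma, Set.mem_sigma_iff, Finset.mem_coe, Finset.mem_filter] at hx hy h
  obtain rfl := frameSection_unique hpq hx.2.2 (h ▸ hy.2.2)
  rw [add_right_cancel h]

lemma frame_eq_union (p q : ℕ) : frame p q = region p q cornerDirs ∪ region p q sideDirs := by
  ext s
  simp only [frame, Set.mem_ofPred_eq, exists_dir_iff, region, cornerDirs, sideDirs,
    Finset.mem_insert, Finset.mem_singleton, exists_eq_or_imp, exists_eq_left, Set.mem_union]
  tauto

lemma disjoint_region {p q : ℕ} (hpq : p < q) :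
    Disjoint (region p q cornerDirs) (region p q sideDirs) := by
  rw [Set.disjoint_left]
  rintro s ⟨d, hd, hs⟩ ⟨e, he, hs'⟩
  obtain rfl := frameSection_unique hpq hs hs'
  exact (by decide : ∀ d ∈ cornerDirs, d ∉ sideDirs) d hd he

lemma sum_frame {p q : ℕ} (hpq : p < q) {T : Finset (ℤ × ℤ)} (hT : (T : Set (ℤ × ℤ)) ⊆ frame p q)
    (f : ℤ × ℤ → ℕ) (α β : ℕ) (hα : ∀ u ∈ region p q cornerDirs, f u = α)
    (hβ : ∀ u ∈ region p q sideDirs, f u = β) :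
    ∑ u ∈ T, f u = α * ((T : Set (ℤ × ℤ)) ∩ region p q cornerDirs).ncard +
      β * ((T : Set (ℤ × ℤ)) ∩ region p q sideDirs).ncard := by
  classical
  have h1 : ∀ D, (T : Set (ℤ × ℤ)) ∩ region p q D = (T.filter (· ∈ region p q D) : Finset _) := by
    intro D; ext; simp
  rw [h1, h1, Set.ncard_coe_finset, Set.ncard_coe_finset, mul_comm α, mul_comm β,
    ← smul_eq_mul, ← smul_eq_mul, ← Finset.sum_const, ← Finset.sum_const,
    ← Finset.sum_filter_add_sum_filter_not T (· ∈ region p q cornerDirs)]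
  congr 1
  · exact Finset.sum_congr rfl fun u hu => hα u (Finset.mem_filter.1 hu).2
  · have : T.filter (· ∉ region p q cornerDirs) = T.filter (· ∈ region p q sideDirs) := by
      refine Finset.filter_congr fun u hu => ?_
      have h2 := hT hu
      rw [frame_eq_union] at h2
      exact ⟨fun h => h2.resolve_left h, fun h h' => (disjoint_region hpq).le_bot ⟨h', h⟩⟩
    rw [this]
    exact Finset.sum_congr rfl fun u hu => hβ u (Finset.mem_filter.1 hu).2

open Classical in
lemma card_filter_cornerDirs (P : SignType × SignType → Prop) :
    (cornerDirs.filter P).card = (if P (1, 1) then 1 else 0) + ((if P (-1, 1) then 1 else 0) +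
      ((if P (-1, -1) then 1 else 0) + if P (1, -1) then 1 else 0)) := by
  rw [Finset.card_filter, cornerDirs, Finset.sum_insert (by decide), Finset.sum_insert (by decide),
    Finset.sum_insert (by decide), Finset.sum_singleton]

open Classical in
lemma card_filter_sideDirs (P : SignType × SignType → Prop) :
    (sideDirs.filter P).card = (if P (1, 0) then 1 else 0) + ((if P (0, 1) then 1 else 0) +
      ((if P (-1, 0) then 1 else 0) + if P (0, -1) then 1 else 0)) := by
  rw [Finset.card_filter, sideDirs, Finset.sum_insert (by decide), Finset.sum_insert (by decide),
    Finset.sum_insert (by decide), Finset.sum_singleton]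

lemma mem_region_cornerDirs {p q : ℕ} {s : ℤ × ℤ} : s ∈ region p q cornerDirs ↔
    s ∈ frameSection p q (1, 1) ∨ s ∈ frameSection p q (-1, 1) ∨
      s ∈ frameSection p q (-1, -1) ∨ s ∈ frameSection p q (1, -1) := by
  simp only [region, cornerDirs, Set.mem_ofPred_eq, Finset.mem_insert, Finset.mem_singleton,
    exists_eq_or_imp, exists_eq_left]

lemma mem_region_sideDirs {p q : ℕ} {s : ℤ × ℤ} : s ∈ region p q sideDirs ↔
    s ∈ frameSection p q (1, 0) ∨ s ∈ frameSection p q (0, 1) ∨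
      s ∈ frameSection p q (-1, 0) ∨ s ∈ frameSection p q (0, -1) := by
  simp only [region, sideDirs, Set.mem_ofPred_eq, Finset.mem_insert, Finset.mem_singleton,
    exists_eq_or_imp, exists_eq_left]

open Classical in
/-- The number of lifts of `u` in the sections of the `(p, q)`-frame in the directions of `D`. -/
noncomputable def liftCount (p q : ℕ) (D : Finset (SignType × SignType)) (u : ℤ × ℤ) : ℕ :=
  (D.filter fun d => u + dirVector ((q : ℤ) - p) p d ∈ frameSection p q d).card

lemma liftCount_cornerDirs {p q : ℕ} {z w : ℤ} : liftCount p q cornerDirs (z, w) =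
    (if (q - 3 * p < 2 * z ∧ 2 * z < (q : ℤ) - p) ∧ (q - 3 * p < 2 * w ∧ 2 * w < (q : ℤ) - p)
      then 1 else 0) +
    ((if (-((q : ℤ) - p) < 2 * z ∧ 2 * z < 3 * p - q) ∧
      (q - 3 * p < 2 * w ∧ 2 * w < (q : ℤ) - p) then 1 else 0) +
    ((if (-((q : ℤ) - p) < 2 * z ∧ 2 * z < 3 * p - q) ∧
      (-((q : ℤ) - p) < 2 * w ∧ 2 * w < 3 * p - q) then 1 else 0) +
    (if (q - 3 * p < 2 * z ∧ 2 * z < (q : ℤ) - p) ∧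
      (-((q : ℤ) - p) < 2 * w ∧ 2 * w < 3 * p - q) then 1 else 0))) := by
  classical
  rw [liftCount, card_filter_cornerDirs]
  simp only [frameSection, Set.mem_ofPred_eq, inBand_one, inBand_neg, dirVector_NE,
    dirVector_NW, dirVector_SW, dirVector_SE, Prod.mk_add_mk]
  congr 1
  · exact if_congr (by omega) rfl rfl
  congr 1
  · exact if_congr (by omega) rfl rfl
  congr 1
  · exact if_congr (by omega) rfl rfl
  · exact if_congr (by omega) rfl rfl

lemma liftCount_sideDirs {p q : ℕ} {z w : ℤ} : liftCount p q sideDirs (z, w) =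
    (if (-((q : ℤ) - p) < 2 * z ∧ 2 * z < 3 * p - q) ∧
      (-((q : ℤ) - p) < 2 * w ∧ 2 * w < (q : ℤ) - p) then 1 else 0) +
    ((if (-((q : ℤ) - p) < 2 * z ∧ 2 * z < (q : ℤ) - p) ∧
      (-((q : ℤ) - p) < 2 * w ∧ 2 * w < 3 * p - q) then 1 else 0) +
    ((if (q - 3 * p < 2 * z ∧ 2 * z < (q : ℤ) - p) ∧
      (-((q : ℤ) - p) < 2 * w ∧ 2 * w < (q : ℤ) - p) then 1 else 0) +
    (if (-((q : ℤ) - p) < 2 * z ∧ 2 * z < (q : ℤ) - p) ∧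
      (q - 3 * p < 2 * w ∧ 2 * w < (q : ℤ) - p) then 1 else 0))) := by
  classical
  rw [liftCount, card_filter_sideDirs]
  simp only [frameSection, Set.mem_ofPred_eq, inBand_one, inBand_zero, inBand_neg, dirVector_E,
    dirVector_N, dirVector_W, dirVector_S, Prod.mk_add_mk]
  congr 1
  · exact if_congr (by omega) rfl rfl
  congr 1
  · exact if_congr (by omega) rfl rfl
  congr 1
  · exact if_congr (by omega) rfl rfl
  · exact if_congr (by omega) rfl rfl

/-- The number of squares of `S` in the corner sections of the `(p, q)`-frame. -/
noncomputable def numCorner (p q : ℕ) (S : Set (ℤ × ℤ)) : ℕ := (S ∩ region p q cornerDirs).ncard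

/-- The number of squares of `S` in the side sections of the `(p, q)`-frame. -/
noncomputable def numSide (p q : ℕ) (S : Set (ℤ × ℤ)) : ℕ := (S ∩ region p q sideDirs).ncard

lemma ncard_eq_numCorner_add_numSide {p q : ℕ} (hpq : p < q) {S : Set (ℤ × ℤ)} (hS : S.Finite)
    (h : S ⊆ frame p q) : S.ncard = numCorner p q S + numSide p q S := by
  rw [numCorner, numSide, ← Set.ncard_union_eq
    ((disjoint_region hpq).mono Set.inter_subset_right Set.inter_subset_right)
    (hS.inter_of_left _) (hS.inter_of_left _), ← Set.inter_union_distrib_left,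
    ← frame_eq_union, Set.inter_eq_left.2 h]

/-- The coefficients form a transfer matrix: α and α' count the corner and side lifts of a corner
square, β and β' those of a side square. The arcs over a corner and over a side square have 3 and 1
squares for f, 1 and 3 for g, 3 and 5 for h. -/
lemma num_lift_of_liftCount {p q a b : ℕ} (hpq : p < q) (hab : a < b) {S : Set (ℤ × ℤ)}
    (hS : S.Finite) (hsub : S ⊆ frame a b) {α β α' β' : ℕ}
    (h1 : ∀ u ∈ region a b cornerDirs, liftCount p q cornerDirs u = α ∧
      liftCount p q sideDirs u = α')
    (h2 : ∀ u ∈ region a b sideDirs, liftCount p q cornerDirs u = β ∧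
      liftCount p q sideDirs u = β') :
    numCorner p q (lift p q ((q : ℤ) - p) p S) = α * numCorner a b S + β * numSide a b S ∧
    numSide p q (lift p q ((q : ℤ) - p) p S) = α' * numCorner a b S + β' * numSide a b S := by
  lift S to Finset (ℤ × ℤ) using hS
  unfold numCorner numSide
  rw [ncard_lift_inter_region hpq _ _ _ _ (by decide),
    ncard_lift_inter_region hpq _ _ _ _ (by decide)]
  exact ⟨sum_frame hab hsub (liftCount p q cornerDirs) α β (fun u hu => (h1 u hu).1)
    fun u hu => (h2 u hu).1, sum_frame hab hsub (liftCount p q sideDirs) α' β'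
      (fun u hu => (h1 u hu).2) fun u hu => (h2 u hu).2⟩

lemma num_liftF {m n : ℕ} (hmn : m < n) {S : Set (ℤ × ℤ)} (hS : S.Finite)
    (hsub : S ⊆ frame m n) :
    numCorner m (2 * m + n) (liftF m n S) = numCorner m n S ∧
    numSide m (2 * m + n) (liftF m n S) = 2 * numCorner m n S + numSide m n S := by
  have := num_lift_of_liftCount (p := m) (q := 2 * m + n) (by omega) hmn hS hsub
    (α := 1) (β := 0) (α' := 2) (β' := 1) ?_ ?_
  · rw [liftF_eq]; omega
  · rintro ⟨z, w⟩ h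
    rw [mem_region_cornerDirs] at h
    simp only [frameSection, Set.mem_ofPred_eq, inBand_one, inBand_neg] at h
    rw [liftCount_cornerDirs, liftCount_sideDirs]
    rcases h with h | h | h | h <;> simp (disch := omega) only [if_pos, if_neg] <;> decide
  · rintro ⟨z, w⟩ h
    rw [mem_region_sideDirs] at h
    simp only [frameSection, Set.mem_ofPred_eq, inBand_one, inBand_zero, inBand_neg] at h
    rw [liftCount_cornerDirs, liftCount_sideDirs]
    rcases h with h | h | h | h <;> simp (disch := omega) only [if_pos, if_neg] <;> decide

lemma num_liftG {m n : ℕ} (hmn : m < n) {S : Set (ℤ × ℤ)} (hS : S.Finite)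
    (hsub : S ⊆ frame m n) :
    numCorner n (2 * n - m) (liftG m n S) = numCorner m n S + 2 * numSide m n S ∧
    numSide n (2 * n - m) (liftG m n S) = numSide m n S := by
  have := num_lift_of_liftCount (p := n) (q := 2 * n - m) (by omega) hmn hS hsub
    (α := 1) (β := 2) (α' := 0) (β' := 1) ?_ ?_
  · rw [liftG_eq hmn]; omega
  · rintro ⟨z, w⟩ h
    rw [mem_region_cornerDirs] at h
    simp only [frameSection, Set.mem_ofPred_eq, inBand_one, inBand_neg] at h
    rw [liftCount_cornerDirs, liftCount_sideDirs]
    rcases h with h | h | h | h <;> simp (disch := omega) only [if_pos, if_neg] <;> decide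
  · rintro ⟨z, w⟩ h
    rw [mem_region_sideDirs] at h
    simp only [frameSection, Set.mem_ofPred_eq, inBand_one, inBand_zero, inBand_neg] at h
    rw [liftCount_cornerDirs, liftCount_sideDirs]
    rcases h with h | h | h | h <;> simp (disch := omega) only [if_pos, if_neg] <;> decide

lemma num_liftH {m n : ℕ} (hmn : m < n) {S : Set (ℤ × ℤ)} (hS : S.Finite)
    (hsub : S ⊆ frame m n) :
    numCorner n (m + 2 * n) (liftH m n S) = numCorner m n S + 2 * numSide m n S ∧
    numSide n (m + 2 * n) (liftH m n S) = 2 * numCorner m n S + 3 * numSide m n S := by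
  have := num_lift_of_liftCount (p := n) (q := m + 2 * n) (by omega) hmn hS hsub
    (α := 1) (β := 2) (α' := 2) (β' := 3) ?_ ?_
  · rw [liftH_eq]; omega
  · rintro ⟨z, w⟩ h
    rw [mem_region_cornerDirs] at h
    simp only [frameSection, Set.mem_ofPred_eq, inBand_one, inBand_neg] at h
    rw [liftCount_cornerDirs, liftCount_sideDirs]
    rcases h with h | h | h | h <;> simp (disch := omega) only [if_pos, if_neg] <;> decide
  · rintro ⟨z, w⟩ h
    rw [mem_region_sideDirs] at h
    simp only [frameSection, Set.mem_ofPred_eq, inBand_one, inBand_zero, inBand_neg] at h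
    rw [liftCount_cornerDirs, liftCount_sideDirs]
    rcases h with h | h | h | h <;> simp (disch := omega) only [if_pos, if_neg] <;> decide

/-- Such a component lies over one isolated hole square, over which the whole octagon is present. -/
lemma num_comp_of_mem_shell {p q m : ℕ} (hp : 0 < p) (hpq : p < q)
    (hm : 2 * p + m = q ∨ q + m = 2 * p) (hmp : m < p) (hodd : Odd (p + q)) {s : ℤ × ℤ}
    (hs : s ∈ frame p q) (h : s ∈ shell p q) :
    numCorner p q (comp p q s) = 4 ∧ numSide p q (comp p q s) = 4 := by
  obtain ⟨⟨z, w⟩, hu⟩ := exists_lifts_of_mem_frame hs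
  rw [hu.mem_shell_iff hpq hm hmp] at h
  have hodd' : Odd (m + p) := by
    rw [Nat.odd_iff] at hodd ⊢; omega
  have hz : (z, w) ∉ frame m p := fun h' => ((mem_frame_iff hmp hodd').1 h').2 h
  rw [comp_eq_lift hp hpq hm hodd hu, comp_eq_singleton hmp hodd' hz, ← Finset.coe_singleton,
    numCorner, numSide, ncard_lift_inter_region hpq _ _ _ _ (by decide),
    ncard_lift_inter_region hpq _ _ _ _ (by decide), Finset.sum_singleton, Finset.sum_singleton]
  change liftCount p q cornerDirs (z, w) = 4 ∧ liftCount p q sideDirs (z, w) = 4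
  rw [liftCount_cornerDirs, liftCount_sideDirs]
  simp (disch := omega) only [if_pos]
  decide

/-! ### Signed continued fractions -/

lemma cfValue_one (c : ℕ → ℤ) (s : ℕ → ℤˣ) : cfValue c s 1 = c 1 := by
  simp [cfValue, signedCF]

lemma lengthRatio_one (c : ℕ → ℤ) (s : ℕ → ℤˣ) : lengthRatio c s 1 = c 1 := by
  simp [lengthRatio, signedCF]

lemma ico_one_succ {k : ℕ} (hk : 1 ≤ k) :
    List.Ico 1 (k + 1) = 1 :: (List.Ico 1 k).map (1 + ·) := by
  rw [List.Ico.eq_cons (by omega), List.Ico.map_add]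

lemma cfValue_succ (c : ℕ → ℤ) (s : ℕ → ℤˣ) {k : ℕ} (hk : 1 ≤ k) :
    cfValue c s (k + 1) =
      c 1 + ((s 1 : ℤ) : ℚ) / cfValue (fun j => c (1 + j)) (fun j => s (1 + j)) k := by
  rw [cfValue, ico_one_succ hk, List.map_cons, List.map_map, signedCF, cfValue, Nat.add_comm 1 k]
  rfl

lemma lengthRatio_succ (c : ℕ → ℤ) (s : ℕ → ℤˣ) {k : ℕ} (hk : 1 ≤ k) :
    lengthRatio c s (k + 1) = c 1 + ((s 1 : ℤ) : ℚ) /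
      (2 - 1 / lengthRatio (fun j => c (1 + j)) (fun j => s (1 + j)) k) := by
  rw [lengthRatio, ico_one_succ hk, List.flatMap_cons, List.flatMap_map, List.cons_append,
    List.cons_append, List.nil_append, signedCF, signedCF, lengthRatio, Nat.add_comm 1 k]
  congr 2
  push_cast
  ring

lemma one_lt_cfValue {k : ℕ} (hk : 1 ≤ k) : ∀ (c : ℕ → ℤ) (s : ℕ → ℤˣ),
    (∀ i ∈ Finset.Icc 1 k, 2 ≤ c i) → 1 < cfValue c s k := by
  induction k, hk using Nat.le_induction with
  | base =>
    intro c s h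
    rw [cfValue_one]
    exact_mod_cast h 1 (by simp)
  | succ k hk ih =>
    intro c s h
    rw [cfValue_succ c s hk]
    have h1 := ih (fun j => c (1 + j)) (fun j => s (1 + j)) fun i hi =>
      h _ (by rw [Finset.mem_Icc] at hi ⊢; omega)
    set v := cfValue (fun j => c (1 + j)) (fun j => s (1 + j)) k
    have h2 : (2 : ℚ) ≤ c 1 := by exact_mod_cast h 1 (by simp)
    have h3 : 1 / v < 1 := by rw [div_lt_one (by linarith)]; exact h1
    have h4 : 0 < 1 / v := by positivity
    rcases Int.units_eq_one_or (s 1) with h5 | h5 <;> rw [h5] <;> push_cast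
    · linarith
    · rw [neg_div]; linarith

lemma IsEvenCF.two_le {c : ℕ → ℤ} {k : ℕ} (h : IsEvenCF c k) {i : ℕ} (hi : i ∈ Finset.Icc 2 k) :
    2 ≤ c i := by
  obtain ⟨r, hr⟩ := h.2.1 i (by rw [Finset.mem_Icc] at hi ⊢; omega)
  have := h.2.2.2 i hi
  omega

lemma IsEvenCF.tail {c : ℕ → ℤ} {k : ℕ} (h : IsEvenCF c (k + 1)) (hk : 1 ≤ k) :
    IsEvenCF (fun j => c (1 + j)) k := by
  refine ⟨hk, fun i hi => h.2.1 _ ?_, ?_, fun i hi => h.2.2.2 _ ?_⟩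
  · rw [Finset.mem_Icc] at hi ⊢; omega
  · exact (h.2.2.2 _ (by rw [Finset.mem_Icc]; omega)).le
  · rw [Finset.mem_Icc] at hi ⊢; omega

/-- The tail has all terms at least 2 and so exceeds 1. Together with evenness this pins down `c 1`
from the value. -/
lemma IsEvenCF.abs_sub_lt_one {c : ℕ → ℤ} {k : ℕ} (h : IsEvenCF c k) (s : ℕ → ℤˣ) :
    |cfValue c s k - c 1| < 1 := by
  obtain _ | _ | k := k
  · exact absurd h.1 (by simp)
  · rw [cfValue_one]; simp
  · rw [cfValue_succ c s (by omega)]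
    have h1 := one_lt_cfValue (k := k + 1) (by omega) (fun j => c (1 + j)) (fun j => s (1 + j))
      fun i hi => h.two_le (by rw [Finset.mem_Icc] at hi ⊢; omega)
    rw [add_sub_cancel_left, abs_div, abs_of_pos (zero_lt_one.trans h1),
      div_lt_one (zero_lt_one.trans h1)]
    rcases Int.units_eq_one_or (s 1) with h5 | h5 <;> rw [h5] <;> simpa using h1

/-- Decreasing the first term by `2`. -/
def subTwo (c : ℕ → ℤ) (j : ℕ) : ℤ := if j = 1 then c 1 - 2 else c j

lemma cfValue_subTwo (c : ℕ → ℤ) (s : ℕ → ℤˣ) {k : ℕ} (hk : 1 ≤ k) :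
    cfValue (subTwo c) s k = cfValue c s k - 2 := by
  obtain _ | _ | k := k
  · omega
  · simp [cfValue_one, subTwo]
  · have : cfValue (fun j => subTwo c (1 + j)) (fun j => s (1 + j)) (k + 1) =
        cfValue (fun j => c (1 + j)) (fun j => s (1 + j)) (k + 1) := by
      unfold cfValue
      congr 1
      · refine List.map_congr_left fun j hj => ?_
        rw [List.Ico.mem] at hj
        simp only [subTwo, if_neg (show 1 + j ≠ 1 by omega)]
      · exact if_neg (by omega)
    rw [cfValue_succ _ s (by omega), cfValue_succ c s (by omega), this, subTwo, if_pos rfl]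
    push_cast
    ring

lemma lengthRatio_subTwo (c : ℕ → ℤ) (s : ℕ → ℤˣ) {k : ℕ} (hk : 1 ≤ k) :
    lengthRatio (subTwo c) s k = lengthRatio c s k - 2 := by
  obtain _ | _ | k := k
  · omega
  · simp [lengthRatio_one, subTwo]
  · have : lengthRatio (fun j => subTwo c (1 + j)) (fun j => s (1 + j)) (k + 1) =
        lengthRatio (fun j => c (1 + j)) (fun j => s (1 + j)) (k + 1) := by
      unfold lengthRatio
      congr 1
      · refine List.flatMap_congr fun j hj => ?_
        rw [List.Ico.mem] at hj
        simp only [subTwo, if_neg (show 1 + j ≠ 1 by omega)]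
      · exact if_neg (by omega)
    rw [lengthRatio_succ _ s (by omega), lengthRatio_succ c s (by omega), this, subTwo, if_pos rfl]
    push_cast
    ring

/-- The arithmetic counterpart of f. A value above 3 forces `c 1 > 2`, so the first term stays
nonnegative. -/
lemma IsEvenCF.subTwo {c : ℕ → ℤ} {k : ℕ} (h : IsEvenCF c k) {s : ℕ → ℤˣ} {p m : ℕ} (hp : 0 < p)
    (hpm : p < m) (hcf : ((2 * p + m : ℕ) : ℚ) / p = cfValue c s k) :
    IsEvenCF (subTwo c) k ∧ (m : ℚ) / p = cfValue (Leaper.subTwo c) s k := by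
  have hp' : (0 : ℚ) < p := by exact_mod_cast hp
  have h1 : ((2 * p + m : ℕ) : ℚ) / p = 2 + m / p := by
    push_cast; field_simp
  have h2 : (1 : ℚ) < m / p := by
    rw [one_lt_div hp']; exact_mod_cast hpm
  have h3 := abs_lt.1 (h.abs_sub_lt_one s)
  rw [← hcf, h1] at h3
  have h4 : 2 < c 1 := by
    have : (2 : ℚ) < c 1 := by linarith
    exact_mod_cast this
  refine ⟨⟨h.1, fun i hi => ?_, ?_, fun i hi => ?_⟩, ?_⟩
  · unfold Leaper.subTwo
    split_ifs
    · exact (h.2.1 1 (by rw [Finset.mem_Icc]; exact ⟨le_rfl, h.1⟩)).sub even_two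
    · exact h.2.1 i hi
  · rw [Leaper.subTwo, if_pos rfl]; omega
  · rw [Leaper.subTwo, if_neg (by rw [Finset.mem_Icc] at hi; omega)]
    exact h.2.2.2 i hi
  · rw [cfValue_subTwo c s h.1, ← hcf, h1]; ring

lemma IsEvenCF.head_eq_two {c : ℕ → ℤ} {k : ℕ} (h : IsEvenCF c k) {s : ℕ → ℤˣ} {p q : ℕ}
    (hp : 0 < p) (hpq : p < q) (hq : q < 3 * p) (hcf : (q : ℚ) / p = cfValue c s k) : c 1 = 2 := by
  have hp' : (0 : ℚ) < p := by exact_mod_cast hp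
  have h1 : (1 : ℚ) < q / p := by
    rw [one_lt_div hp']; exact_mod_cast hpq
  have h2 : (q : ℚ) / p < 3 := by
    rw [div_lt_iff₀ hp']; exact_mod_cast hq
  have h3 := abs_lt.1 (h.abs_sub_lt_one s)
  rw [← hcf] at h3
  have h4 : 0 < c 1 := by
    have : (0 : ℚ) < c 1 := by linarith
    exact_mod_cast this
  have h5 : c 1 < 4 := by
    have : (c 1 : ℚ) < 4 := by linarith
    exact_mod_cast this
  obtain ⟨r, hr⟩ := h.2.1 1 (by rw [Finset.mem_Icc]; exact ⟨le_rfl, h.1⟩)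
  omega

/-- The arithmetic counterpart of g and h: q/p = 2 ± 1/(p/m), where the sign is that of q - 2p
because the tail is positive. -/
lemma IsEvenCF.tail_eq {c : ℕ → ℤ} {k : ℕ} (hk : 1 ≤ k) (h : IsEvenCF c (k + 1)) {s : ℕ → ℤˣ}
    {p q m : ℕ} (hp : 0 < p) (hpq : p < q) (hm : 2 * p + m = q ∨ q + m = 2 * p) (hmp : m < p)
    (hcf : (q : ℚ) / p = cfValue c s (k + 1)) :
    0 < m ∧ ((s 1 = 1 ∧ 2 * p + m = q) ∨ (s 1 = -1 ∧ q + m = 2 * p)) ∧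
      (p : ℚ) / m = cfValue (fun j => c (1 + j)) (fun j => s (1 + j)) k := by
  have hp' : (0 : ℚ) < p := by exact_mod_cast hp
  have h1 := h.head_eq_two hp hpq (by omega) hcf
  have hv := one_lt_cfValue hk (fun j => c (1 + j)) (fun j => s (1 + j))
    fun i hi => h.two_le (by rw [Finset.mem_Icc] at hi ⊢; omega)
  rw [cfValue_succ c s hk, h1] at hcf
  set v := cfValue (fun j => c (1 + j)) (fun j => s (1 + j)) k
  have hv0 : v ≠ 0 := by linarith
  rw [div_eq_iff hp'.ne', add_mul, div_mul_eq_mul_div] at hcf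
  have key : ∀ ε : ℤ, (s 1 : ℤ) = ε → (((q : ℤ) - 2 * p : ℤ) : ℚ) * v = ε * p := by
    rintro _ rfl
    have : (((q : ℤ) - 2 * p : ℤ) : ℚ) = ((s 1 : ℤ) : ℚ) * p / v := by
      push_cast; push_cast at hcf; rw [hcf]; ring
    rw [this, div_mul_cancel₀ _ hv0]
  rcases Int.units_eq_one_or (s 1) with h5 | h5
  · have h6 := key 1 (by rw [h5]; rfl)
    have h7 : 0 < (q : ℤ) - 2 * p := by
      by_contra! h8
      have : (((q : ℤ) - 2 * p : ℤ) : ℚ) ≤ 0 := by exact_mod_cast h8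
      push_cast at h6 this
      nlinarith
    have h8 : (q : ℤ) - 2 * p = m := by omega
    rw [h8] at h6
    have hm0 : 0 < m := by omega
    refine ⟨hm0, .inl ⟨h5, by omega⟩, ?_⟩
    rw [div_eq_iff (by positivity)]
    push_cast at h6
    linarith
  · have h6 := key (-1) (by rw [h5]; rfl)
    have h7 : (q : ℤ) - 2 * p < 0 := by
      by_contra! h8
      have : 0 ≤ (((q : ℤ) - 2 * p : ℤ) : ℚ) := by exact_mod_cast h8
      push_cast at h6 this
      nlinarith
    have h8 : (q : ℤ) - 2 * p = -m := by omega
    rw [h8] at h6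
    have hm0 : 0 < m := by omega
    refine ⟨hm0, .inr ⟨h5, by omega⟩, ?_⟩
    rw [div_eq_iff (by positivity)]
    push_cast at h6
    linarith

/-! ### Lifting of components -/

lemma comp_comm (p q : ℕ) (s : ℤ × ℤ) : comp p q s = comp q p s := by
  rw [comp, comp, boardGraph_comm]

lemma finite_comp {p q : ℕ} (hpq : p < q) (hodd : Odd (p + q)) {s : ℤ × ℤ} (hs : s ∈ frame p q) :
    (comp p q s).Finite :=
  (finite_board (p + q)).subset ((comp_subset_frame hpq hodd hs).trans (frame_subset_board hpq hodd))

/-- Lifting is taking preimages, so it is injective on sets over which every fibre is nonempty. -/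
lemma lift_injective {p q : ℕ} (hpq : p < q) {S T : Set (ℤ × ℤ)}
    (hS : ∀ u ∈ S, ∃ s, Lifts p q s u) (hT : ∀ u ∈ T, ∃ s, Lifts p q s u)
    (h : lift p q ((q : ℤ) - p) p S = lift p q ((q : ℤ) - p) p T) : S = T := by
  have key : ∀ S T : Set (ℤ × ℤ), (∀ u ∈ S, ∃ s, Lifts p q s u) →
      lift p q ((q : ℤ) - p) p S = lift p q ((q : ℤ) - p) p T → S ⊆ T := by
    intro S T hS h u hu
    obtain ⟨s, hs⟩ := hS u hu
    obtain ⟨v, hv, hs'⟩ := mem_lift_iff.1 (h ▸ mem_lift_iff.2 ⟨u, hu, hs⟩)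
    exact hs.right_unique hpq hs' ▸ hv
  exact (key S T hS h).antisymm (key T S hT h.symm)

lemma exists_comp_eq_liftF {m n : ℕ} (hm : 0 < m) (hodd : Odd (m + n)) {u : ℤ × ℤ}
    (hu : u ∈ frame m n) :
    ∃ s ∈ frame m (2 * m + n), liftF m n (comp m n u) = comp m (2 * m + n) s := by
  obtain ⟨s, hs⟩ := exists_lifts_of_lt hu
  have hodd' : Odd (m + (2 * m + n)) := by rw [Nat.odd_iff] at hodd ⊢; omega
  exact ⟨s, hs.mem_frame_left, by
    rw [comp_eq_lift hm (by omega) (.inl rfl) hodd' hs, liftF_eq, comp_comm n m]⟩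

lemma exists_comp_eq_lift {p q m : ℕ} (hpq : p < q) (hm : 2 * p + m = q ∨ q + m = 2 * p)
    (hmp : m < p) (hodd : Odd (p + q)) {u : ℤ × ℤ} (hu : u ∈ frame m p) :
    ∃ s ∈ frame p q, lift p q ((q : ℤ) - p) p (comp m p u) = comp p q s := by
  have hodd' : Odd (m + p) := by rw [Nat.odd_iff] at hodd ⊢; omega
  obtain ⟨s, hs⟩ := exists_lifts_of_gt hm hmp (frame_subset_board hmp hodd' hu)
  exact ⟨s, hs.mem_frame_left, (comp_eq_lift (by omega) hpq hm hodd hs).symm⟩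

lemma HasType.exists_comp {p q i : ℕ} {S : Set (ℤ × ℤ)} (h : HasType p q i S)
    (hodd : Odd (p + q)) : 0 < p ∧ p < q ∧ 1 ≤ i ∧ ∃ s ∈ frame p q, S = comp p q s := by
  induction h with
  | shell m n S hm hmn hn hS hsub =>
    exact ⟨hm, hmn, le_rfl, (isCycleSet_iff hm hmn hodd).1 hS⟩
  | f m n i S hmn hS ih =>
    have hodd' : Odd (m + n) := by rw [Nat.odd_iff] at hodd ⊢; omega
    obtain ⟨h1, -, h2, u, hu, rfl⟩ := ih hodd'
    exact ⟨h1, by omega, h2, exists_comp_eq_liftF h1 hodd' hu⟩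
  | g m n i S hmn hS ih =>
    have hodd' : Odd (m + n) := by rw [Nat.odd_iff] at hodd ⊢; omega
    obtain ⟨h1, -, -, u, hu, rfl⟩ := ih hodd'
    refine ⟨by omega, by omega, by omega, ?_⟩
    rw [liftG_eq hmn]
    exact exists_comp_eq_lift (by omega) (.inr (by omega)) hmn hodd hu
  | h m n i S hmn hS ih =>
    have hodd' : Odd (m + n) := by rw [Nat.odd_iff] at hodd ⊢; omega
    obtain ⟨h1, -, -, u, hu, rfl⟩ := ih hodd'
    refine ⟨by omega, by omega, by omega, ?_⟩
    rw [liftH_eq]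
    exact exists_comp_eq_lift (by omega) (.inl (by omega)) hmn hodd hu

/-- Here q > 3p, whereas the shell rule needs q ≤ 3p, g yields q < 2p and h yields q < 3p. -/
lemma hasType_of_lt_iff {p m i : ℕ} (hpm : p < m) {S : Set (ℤ × ℤ)} :
    HasType p (2 * p + m) i S ↔ ∃ S', HasType p m i S' ∧ S = liftF p m S' := by
  constructor
  -- The index must be a variable for `cases` to unify it with those of the constructors.
  · generalize hq : 2 * p + m = q
    intro h
    cases h with
    | shell => omega
    | f _ n _ S' hmn hS =>
      obtain rfl : m = n := by omega
      exact ⟨S', hS, rfl⟩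
    | g => omega
    | h => omega
  · rintro ⟨S', hS, rfl⟩
    exact .f _ _ _ _ hpm hS

lemma hasType_of_gt_iff {p q m i : ℕ} (hp : 0 < p) (hpq : p < q)
    (hm : 2 * p + m = q ∨ q + m = 2 * p) (hmp : m < p) {S : Set (ℤ × ℤ)} :
    HasType p q i S ↔ (i = 1 ∧ IsCycleSet p q S ∧ S ⊆ shell p q) ∨
      ∃ i' S', i = i' + 1 ∧ HasType m p i' S' ∧ S = lift p q ((q : ℤ) - p) p S' := by
  constructor
  · intro h
    cases h with
    | shell _ _ _ _ _ _ hS hsub => exact .inl ⟨rfl, hS, hsub⟩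
    | f => omega
    | g m' _ i S' hmn hS =>
      obtain rfl : m = m' := by omega
      exact .inr ⟨_, _, rfl, hS, liftG_eq hmp _⟩
    | h m' _ i S' hmn hS =>
      obtain rfl : m = m' := by omega
      exact .inr ⟨_, _, rfl, hS, liftH_eq _ _ _⟩
  · rintro (⟨rfl, hS, hsub⟩ | ⟨i', S', rfl, hS, rfl⟩)
    · exact .shell _ _ _ hp hpq (by omega) hS hsub
    · rcases hm with hm | hm
      · obtain rfl : q = m + 2 * p := by omega
        rw [← liftH_eq]
        exact .h _ _ _ _ hmp hS
      · obtain rfl : q = 2 * p - m := by omega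
        rw [← liftG_eq hmp]
        exact .g _ _ _ _ hmp hS

lemma comp_subset_shell {p q m : ℕ} (hpq : p < q) (hm : 2 * p + m = q ∨ q + m = 2 * p)
    (hmp : m < p) (hodd : Odd (p + q)) {s : ℤ × ℤ} (hs : s ∈ frame p q) (h : s ∈ shell p q) :
    comp p q s ⊆ shell p q := by
  obtain ⟨⟨z, w⟩, hu⟩ := exists_lifts_of_mem_frame hs
  have h0 := (hu.mem_shell_iff hpq hm hmp).1 h
  have hodd' : Odd (m + p) := by rw [Nat.odd_iff] at hodd ⊢; omega
  have hz : (z, w) ∉ frame m p := fun h' => ((mem_frame_iff hmp hodd').1 h').2 h0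
  rw [comp_eq_lift (by omega) hpq hm hodd hu, comp_eq_singleton hmp hodd' hz]
  intro t ht
  obtain ⟨_, rfl, ht⟩ := mem_lift_iff.1 ht
  exact (ht.mem_shell_iff hpq hm hmp).2 h0

/-- The dichotomy behind types: a square either lies in the shell or comes from a cycle of the
smaller leaper. -/
lemma Lifts.mem_frame_iff {p q m : ℕ} (hpq : p < q) (hm : 2 * p + m = q ∨ q + m = 2 * p)
    (hmp : m < p) (hodd : Odd (p + q)) {s u : ℤ × ℤ} (h : Lifts p q s u) :
    u ∈ frame m p ↔ s ∉ shell p q := by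
  have hodd' : Odd (m + p) := by rw [Nat.odd_iff] at hodd ⊢; omega
  obtain ⟨z, w⟩ := u
  rw [h.mem_shell_iff hpq hm hmp, Leaper.mem_frame_iff hmp hodd']
  exact and_iff_right (h.mem_board hm)

/-! ### Descent -/

/-- The classification of the components of the frame by type, with the numbers of their squares in
the corner sections and in all sections. -/
structure Classified (p q : ℕ) (c : ℕ → ℤ) (s : ℕ → ℤˣ) (k : ℕ) : Prop where
  exists_type : ∀ u ∈ frame p q, ∃ i ∈ Finset.Icc 1 k, HasType p q i (comp p q u)
  type_unique : ∀ i j S, HasType p q i S → HasType p q j S → i = j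
  exists_comp : ∀ i ∈ Finset.Icc 1 k, ∃ u ∈ frame p q, HasType p q i (comp p q u)
  -- The corner count is carried along because the totals alone do not determine the totals after
  -- lifting. The bounds 0 < d ≤ l keep 2l - d positive in the next step.
  num : ∀ i ∈ Finset.Icc 1 k, ∀ S, HasType p q i S → ∃ l d : ℤ, 0 < d ∧ d ≤ l ∧ IsCoprime l d ∧
    lengthRatio c s i = l / d ∧ (numCorner p q S : ℤ) = 4 * d ∧
    (numCorner p q S : ℤ) + numSide p q S = 4 * l

lemma Classified.of_subTwo {p m k : ℕ} {c : ℕ → ℤ} {s : ℕ → ℤˣ} (hp : 0 < p) (hpm : p < m)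
    (hodd : Odd (p + m)) (h : Classified p m (subTwo c) s k) : Classified p (2 * p + m) c s k where
  exists_type t ht := by
    have hodd' : Odd (p + (2 * p + m)) := by rw [Nat.odd_iff] at hodd ⊢; omega
    obtain ⟨u, hu⟩ := exists_lifts_of_mem_frame ht
    obtain ⟨i, hi, h1⟩ := h.exists_type u (hu.mem_frame_of_lt hpm hodd)
    refine ⟨i, hi, (hasType_of_lt_iff hpm).2 ⟨_, h1, ?_⟩⟩
    rw [comp_eq_lift hp (by omega) (.inl rfl) hodd' hu, liftF_eq, comp_comm m p]
  type_unique i j S hi hj := by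
    obtain ⟨S1, h1, rfl⟩ := (hasType_of_lt_iff hpm).1 hi
    obtain ⟨S2, h2, h3⟩ := (hasType_of_lt_iff hpm).1 hj
    rw [liftF_eq, liftF_eq] at h3
    obtain ⟨-, -, -, u1, hu1, rfl⟩ := h1.exists_comp hodd
    obtain ⟨-, -, -, u2, hu2, rfl⟩ := h2.exists_comp hodd
    have h4 := lift_injective (by omega)
      (fun u hu => exists_lifts_of_lt (comp_subset_frame hpm hodd hu1 hu))
      (fun u hu => exists_lifts_of_lt (comp_subset_frame hpm hodd hu2 hu)) h3
    exact h.type_unique _ _ _ h1 (h4 ▸ h2)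
  exists_comp i hi := by
    obtain ⟨u, hu, h1⟩ := h.exists_comp i hi
    obtain ⟨t, ht, h2⟩ := exists_comp_eq_liftF hp hodd hu
    exact ⟨t, ht, (hasType_of_lt_iff hpm).2 ⟨_, h1, h2.symm⟩⟩
  num i hi S hS := by
    obtain ⟨S', h1, rfl⟩ := (hasType_of_lt_iff hpm).1 hS
    obtain ⟨-, -, -, u, hu, rfl⟩ := h1.exists_comp hodd
    obtain ⟨l, d, hd, hl, ⟨a, b, hab⟩, h2, h3, h4⟩ := h.num i hi _ h1
    obtain ⟨h5, h6⟩ := num_liftF hpm (finite_comp hpm hodd hu) (comp_subset_frame hpm hodd hu)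
    rw [lengthRatio_subTwo _ _ (Finset.mem_Icc.1 hi).1, sub_eq_iff_eq_add] at h2
    have hd' : (d : ℚ) ≠ 0 := by exact_mod_cast hd.ne'
    refine ⟨l + 2 * d, d, hd, by omega, ⟨a, b - 2 * a, by linear_combination hab⟩, ?_, ?_, ?_⟩
    · rw [h2]; push_cast; field_simp
    · rw [h5]; exact h3
    · rw [h5, h6]; push_cast; linarith

/-- In the alternative k = 0, m = 0 the smaller frame is empty, so every component lies in the shell
and the descent stops. -/
lemma Classified.of_tail {p q m k : ℕ} {c : ℕ → ℤ} {s : ℕ → ℤˣ} (hp : 0 < p) (hpq : p < q)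
    (hm : 2 * p + m = q ∨ q + m = 2 * p) (hmp : m < p) (hodd : Odd (p + q)) (hc : c 1 = 2)
    (h : (k = 0 ∧ m = 0) ∨ (((s 1 = 1 ∧ 2 * p + m = q) ∨ (s 1 = -1 ∧ q + m = 2 * p)) ∧
      Classified m p (fun j => c (1 + j)) (fun j => s (1 + j)) k)) :
    Classified p q c s (k + 1) := by
  have hodd' : Odd (m + p) := by rw [Nat.odd_iff] at hodd ⊢; omega
  have hk : ∀ {u}, u ∈ frame m p → ((s 1 = 1 ∧ 2 * p + m = q) ∨ (s 1 = -1 ∧ q + m = 2 * p)) ∧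
      Classified m p (fun j => c (1 + j)) (fun j => s (1 + j)) k := by
    rintro ⟨z, w⟩ hu
    refine h.resolve_left fun ⟨_, h0⟩ => ?_
    rw [Leaper.mem_frame_iff hmp hodd', mem_board_iff] at hu
    omega
  have hT : ∀ {i S}, HasType m p i S → ∃ u ∈ frame m p, S = comp m p u := fun hS =>
    (hS.exists_comp hodd').2.2.2
  have hl : ∀ {u}, u ∈ frame m p → ∀ v ∈ comp m p u, ∃ t, Lifts p q t v := fun hu v hv =>
    exists_lifts_of_gt hm hmp (frame_subset_board hmp hodd' (comp_subset_frame hmp hodd' hu hv))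
  have hshell : ∀ {i S}, HasType m p i S → ¬ lift p q ((q : ℤ) - p) p S ⊆ shell p q := by
    intro i S hS hsub
    obtain ⟨u, hu, rfl⟩ := hT hS
    obtain ⟨t, ht⟩ := hl hu u (self_mem_comp _ _ _)
    exact (ht.mem_frame_iff hpq hm hmp hodd).1 hu
      (hsub (mem_lift_iff.2 ⟨u, self_mem_comp _ _ _, ht⟩))
  refine ⟨fun t ht => ?_, fun i j S hi hj => ?_, fun i hi => ?_, fun i hi S hS => ?_⟩
  · by_cases hts : t ∈ shell p q
    · exact ⟨1, by simp, (hasType_of_gt_iff hp hpq hm hmp).2 (.inl ⟨rfl,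
        isCycleSet_comp hp hpq hodd ht, comp_subset_shell hpq hm hmp hodd ht hts⟩)⟩
    · obtain ⟨u, hu⟩ := exists_lifts_of_mem_frame ht
      have hu' := (hu.mem_frame_iff hpq hm hmp hodd).2 hts
      obtain ⟨i, hi, h1⟩ := (hk hu').2.exists_type u hu'
      exact ⟨i + 1, by rw [Finset.mem_Icc] at hi ⊢; omega, (hasType_of_gt_iff hp hpq hm hmp).2
        (.inr ⟨i, _, rfl, h1, comp_eq_lift hp hpq hm hodd hu⟩)⟩
  · rcases (hasType_of_gt_iff hp hpq hm hmp).1 hi with ⟨rfl, -, h1⟩ | ⟨i, S1, rfl, h1, rfl⟩ <;>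
      rcases (hasType_of_gt_iff hp hpq hm hmp).1 hj with ⟨rfl, -, h2⟩ | ⟨j, S2, rfl, h2, h3⟩
    · rfl
    · exact absurd (h3 ▸ h1) (hshell h2)
    · exact absurd h2 (hshell h1)
    · obtain ⟨u1, hu1, rfl⟩ := hT h1
      obtain ⟨u2, hu2, rfl⟩ := hT h2
      have h4 := lift_injective hpq (hl hu1) (hl hu2) h3
      rw [(hk hu1).2.type_unique _ _ _ h1 (h4 ▸ h2)]
  · obtain rfl | hi1 := eq_or_ne i 1
    -- The central square always lies in the hole, so its octagon is a cycle of type 1.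
    · obtain ⟨t, ht⟩ := exists_lifts_of_gt (p := p) (q := q) hm hmp (u := (0, 0))
        (mem_board_iff.2 (by omega))
      have hts : t ∈ shell p q := (ht.mem_shell_iff hpq hm hmp).2 (by omega)
      exact ⟨t, ht.mem_frame_left, (hasType_of_gt_iff hp hpq hm hmp).2 (.inl ⟨rfl,
        isCycleSet_comp hp hpq hodd ht.mem_frame_left,
        comp_subset_shell hpq hm hmp hodd ht.mem_frame_left hts⟩)⟩
    · rw [Finset.mem_Icc] at hi
      obtain ⟨i, rfl⟩ : ∃ j, i = j + 1 := ⟨i - 1, by omega⟩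
      obtain ⟨-, hC⟩ := h.resolve_left (by omega)
      obtain ⟨u, hu, h1⟩ := hC.exists_comp i (by rw [Finset.mem_Icc]; omega)
      obtain ⟨t, ht, h2⟩ := exists_comp_eq_lift hpq hm hmp hodd hu
      exact ⟨t, ht, (hasType_of_gt_iff hp hpq hm hmp).2 (.inr ⟨i, _, rfl, h1, h2.symm⟩)⟩
  · rcases (hasType_of_gt_iff hp hpq hm hmp).1 hS with ⟨rfl, h1, h2⟩ | ⟨i, S, rfl, h1, rfl⟩
    · obtain ⟨t, ht, rfl⟩ := (isCycleSet_iff hp hpq hodd).1 h1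
      obtain ⟨h3, h4⟩ := num_comp_of_mem_shell hp hpq hm hmp hodd ht (h2 (self_mem_comp _ _ _))
      refine ⟨2, 1, by norm_num, by norm_num, isCoprime_one_right, ?_, by omega, by omega⟩
      rw [lengthRatio_one, hc]; norm_num
    · have hi' := (h1.exists_comp hodd').2.2.1
      obtain ⟨u, hu, rfl⟩ := hT h1
      obtain ⟨hs, hC⟩ := hk hu
      rw [Finset.mem_Icc] at hi
      obtain ⟨l, d, hd, hl, ⟨a, b, hab⟩, h2, h3, h4⟩ :=
        hC.num i (by rw [Finset.mem_Icc]; omega) _ h1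
      have hfin := finite_comp hmp hodd' hu
      have hsub := comp_subset_frame hmp hodd' hu
      have hd' : (d : ℚ) ≠ 0 := by exact_mod_cast hd.ne'
      have hl' : (l : ℚ) ≠ 0 := by exact_mod_cast (by omega : l ≠ 0)
      have hld : (2 * l - d : ℚ) ≠ 0 := by exact_mod_cast (by omega : 2 * l - d ≠ 0)
      have h5 : (2 : ℚ) - 1 / (l / d) = (2 * l - d) / l := by field_simp
      rw [lengthRatio_succ c s hi', h2, hc, h5]
      rcases hs with ⟨hs, hm⟩ | ⟨hs, hm⟩
      · obtain rfl : q = m + 2 * p := by omega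
        obtain ⟨h6, h7⟩ := num_liftH hmp hfin hsub
        rw [← liftH_eq, h6, h7, hs]
        -- From 2 + 1/(2 - d/l) = (5l - 2d)/(2l - d); the map on (l, d) has determinant 1, which
        -- gives the Bézout coefficients.
        refine ⟨5 * l - 2 * d, 2 * l - d, by omega, by omega,
          ⟨a + 2 * b, -2 * a - 5 * b, by linear_combination hab⟩, ?_, ?_, ?_⟩
        · push_cast; field_simp; ring
        · push_cast; linarith
        · push_cast; linarith
      · obtain rfl : q = 2 * p - m := by omega
        obtain ⟨h6, h7⟩ := num_liftG hmp hfin hsub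
        rw [← liftG_eq hmp, h6, h7, hs]
        -- From 2 - 1/(2 - d/l) = (3l - 2d)/(2l - d); here the determinant is again a unit.
        refine ⟨3 * l - 2 * d, 2 * l - d, by omega, by omega,
          ⟨-a - 2 * b, 2 * a + 3 * b, by linear_combination hab⟩, ?_, ?_, ?_⟩
        · push_cast; field_simp; ring
        · push_cast; linarith
        · push_cast; linarith

/-- Euclidean descent on the larger number: (p, q) passes to (p, q - 2p) when q > 3p and to (|q -
2p|, p) when q < 3p. -/
theorem classified {q : ℕ} : ∀ {p : ℕ}, 0 < p → p < q → Nat.Coprime p q → Odd (p + q) →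
    ∀ {k : ℕ} {c : ℕ → ℤ} {s : ℕ → ℤˣ}, IsEvenCF c k → (q : ℚ) / p = cfValue c s k →
    Classified p q c s k := by
  induction q using Nat.strong_induction_on with
  | _ q ih =>
    intro p hp hpq hcop hodd k c s hc hcf
    -- Otherwise p + q = 4p would be even.
    have h3 : q ≠ 3 * p := by
      rintro rfl
      rw [Nat.odd_iff] at hodd
      omega
    rcases lt_or_gt_of_ne h3 with h3 | h3
    · obtain ⟨m, hm⟩ : ∃ m, 2 * p + m = q ∨ q + m = 2 * p := by
        rcases le_total (2 * p) q with h | h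
        · exact ⟨q - 2 * p, by omega⟩
        · exact ⟨2 * p - q, by omega⟩
      have hmp : m < p := by omega
      obtain ⟨k, rfl⟩ : ∃ j, k = j + 1 := ⟨k - 1, by have := hc.1; omega⟩
      have hc1 := hc.head_eq_two hp hpq h3 hcf
      refine .of_tail hp hpq hm hmp hodd hc1 ?_
      rcases Nat.eq_zero_or_pos k with rfl | hk
      · refine .inl ⟨rfl, ?_⟩
        rw [cfValue_one, hc1, div_eq_iff (by positivity)] at hcf
        have : q = 2 * p := by exact_mod_cast hcf
        omega
      · obtain ⟨hm0, h1, h2⟩ := hc.tail_eq hk hp hpq hm hmp hcf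
        refine .inr ⟨h1, ih p hpq hm0 hmp ?_ ?_ (hc.tail hk) h2⟩
        · rcases hm with hm | hm
          · subst hm
            rw [Nat.coprime_comm]
            simpa using hcop
          · have h5 : Nat.gcd m p ∣ q := by
              have h6 : Nat.gcd m p ∣ q + m := hm ▸ (Nat.gcd_dvd_right m p).mul_left 2
              exact (Nat.dvd_add_left (Nat.gcd_dvd_left m p)).1 h6
            exact Nat.dvd_one.1 (hcop ▸ Nat.dvd_gcd (Nat.gcd_dvd_right m p) h5)
        · rw [Nat.odd_iff] at hodd ⊢; omega
    · obtain ⟨m, rfl⟩ : ∃ m, q = 2 * p + m := ⟨q - 2 * p, by omega⟩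
      have hpm : p < m := by omega
      have hodd' : Odd (p + m) := by rw [Nat.odd_iff] at hodd ⊢; omega
      obtain ⟨h1, h2⟩ := hc.subTwo hp hpm hcf
      exact .of_subTwo hp hpm hodd' (ih m (by omega) hp hpm (by simpa using hcop) hodd' h1 h2)

end Leaper

/-! ### From components back to cycles -/

theorem mainTheorem3 (p q : ℕ) (hp : 0 < p) (hpq : p < q) (hcop : Nat.Coprime p q)
    (hodd : Odd (p + q)) (k : ℕ) (c : ℕ → ℤ) (s : ℕ → ℤˣ) (hc : Leaper.IsEvenCF c k)
    (hcf : (q : ℚ) / (p : ℚ) = Leaper.cfValue c s k) :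
    (∀ (a : Leaper.board (p + q)) (C : (Leaper.leaperGraph p q).Walk a a), C.IsCycle →
      ∃! i : ℕ, i ∈ Finset.Icc 1 k ∧ Leaper.HasType p q i (Leaper.squares C)) ∧
    (∀ i ∈ Finset.Icc 1 k,
      ∃ (a : Leaper.board (p + q)) (C : (Leaper.leaperGraph p q).Walk a a),
        C.IsCycle ∧ Leaper.HasType p q i (Leaper.squares C)) ∧
    (∀ i ∈ Finset.Icc 1 k,
      ∀ (a : Leaper.board (p + q)) (C : (Leaper.leaperGraph p q).Walk a a), C.IsCycle →
        Leaper.HasType p q i (Leaper.squares C) →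
          (C.length : ℤ) = 4 * (Leaper.lengthRatio c s i).num) := by
  have h := Leaper.classified hp hpq hcop hodd hc hcf
  refine ⟨fun a C hC => ?_, fun i hi => ?_, fun i hi a C hC hT => ?_⟩
  · obtain ⟨h1, h2⟩ := Leaper.squares_eq_comp hp hpq hodd hC
    rw [h1]
    obtain ⟨i, hi, h3⟩ := h.exists_type a h2
    exact ⟨i, ⟨hi, h3⟩, fun j hj => h.type_unique _ _ _ hj.2 h3⟩
  · obtain ⟨u, hu, h1⟩ := h.exists_comp i hi
    obtain ⟨a, C, hC, h2⟩ := Leaper.isCycleSet_comp hp hpq hodd hu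
    exact ⟨a, C, hC, h2 ▸ h1⟩
  · obtain ⟨l, d, hd, -, hcop, h1, -, h3⟩ := h.num i hi _ hT
    obtain ⟨h4, h5⟩ := Leaper.squares_eq_comp hp hpq hodd hC
    have h6 := Leaper.ncard_eq_numCorner_add_numSide hpq (S := Leaper.squares C)
      (h4 ▸ Leaper.finite_comp hpq hodd h5) (h4 ▸ Leaper.comp_subset_frame hpq hodd h5)
    -- Coprimality of l and d makes l the numerator of the ratio, and 4l is the number of squares.
    rw [h1, Rat.num_div_eq_of_coprime hd (Int.isCoprime_iff_nat_coprime.1 hcop), ← h3,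
      Leaper.length_eq_ncard_squares hC, h6]
    push_cast
    rfl
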